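/- Let $\tau_0=\mathrm{diag}(\tau_{11},\tau_{22},\tau_{33})$ with $\mathrm{Im}\,\tau_{jj}>0$. Let $A=\mathbb C^3/\Lambda$, where $\Lambda$ is the lattice generated by $\tau_{jj}e_j$, $2e_j$ $(j=1,2,3)$ and $e_1+e_2+e_3$; that is, $A=(E_1\times E_2\times E_3)/\langle e_1+e_2+e_3\rangle$ with $E_j=\mathbb C/\langle 2,\tau_{jj}\rangle$. Let $\mathcal L$ be the line bundle of type $(1,2,2)$ on $A$ whose sections are the entire functions $s$ on $\mathbb C^3$ with $s(z+2e_j)=s(z)$, $s(z+e_1+e_2+e_3)=s(z)$ and $s(z+\tau_{jj}e_j)=e^{-\pi i\tau_{jj}-2\pi i z_j}s(z)$ for $j=1,2,3$. Let $\mathcal B(\mathcal L)\subset A$ be the set of base points of $|\mathcal L|$, i.e. the set of common zeros of all sections of $\mathcal L$. Put $$\theta_0(z,t)=\sum_{n\in\mathbb Z}e^{\pi i n^2t+2\pi i nz},\qquad \theta_1(z,t)=e^{\pi i t/4+\pi i z}\,\theta_0(z+t/2,t),$$ $$\theta_{ijk}(z)=\theta_i(z_1,\tau_{11})\,\theta_j(z_2,\tau_{22})\,\theta_k(z_3,\tau_{33}).$$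 Then $\mathcal B(\mathcal L)$ has exactly $16$ points. Moreover, for general $(b,c,d)\in\mathbb C^3$ (i.e. for all $(b,c,d)$ at which a certain non-zero polynomial, depending only on $\tau_0$, does not vanish) the surface $$\mathcal S:\ \theta_{000}+b\,\theta_{011}+c\,\theta_{101}+d\,\theta_{110}=0$$ in $A$ is smooth and contains $\mathcal B(\mathcal L)$, and the canonical map of $\mathcal S$, which sends a point $P\in\mathcal S$ to the hyperplane of those holomorphic $2$-forms in $H^0(\mathcal S,\omega_{\mathcal S})$ which vanish at $P$, is defined at every point of $\mathcal B(\mathcal L)$ and its restriction to $\mathcal B(\mathcal L)$ is injective. -/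

import Mathlib

namespace CanonicalMap122

noncomputable section

/-- The universal cover of the abelian threefold. -/
abbrev V : Type := Fin 3 → ℂ

/-! ### The abelian threefold and its polarization -/

/-- The lattice of `A`: it is generated by the periods `τ_jj e_j` and `2 e_j` of the product
`T = E₁ × E₂ × E₃`, where `E_j = ℂ / ⟨2, τ_jj⟩`, and by the vector `e₁ + e₂ + e₃`. -/
def lattice (τ : Fin 3 → UpperHalfPlane) : AddSubgroup V :=
  AddSubgroup.closure
    (Set.range (fun j : Fin 3 => (Pi.single j (τ j : ℂ) : V)) ∪
      Set.range (fun j : Fin 3 => (Pi.single j 2 : V)) ∪ {(fun _ => 1 : V)})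

/-- The abelian threefold `A = T / ⟨e₁ + e₂ + e₃⟩ = ℂ³ / lattice`. -/
abbrev Threefold (τ : Fin 3 → UpperHalfPlane) : Type := V ⧸ lattice τ

/-- The projection `ℂ³ → A`. -/
def proj (τ : Fin 3 → UpperHalfPlane) (z : V) : Threefold τ := QuotientAddGroup.mk z

/-- `H⁰(A, 𝓛)`: the entire functions on `ℂ³` satisfying the functional equations of the line
bundle `𝓛` of type `(1,2,2)` for the generators of the lattice. The factor of automorphy is
trivial on `2 e_j` and on `e₁ + e₂ + e₃`, and is `exp (-π i τ_jj - 2 π i z_j)` on `τ_jj e_j`. -/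
def sections (τ : Fin 3 → UpperHalfPlane) : Submodule ℂ (V → ℂ) where
  carrier := {s | Differentiable ℂ s ∧
    (∀ (z : V) (j : Fin 3), s (z + Pi.single j 2) = s z) ∧
    (∀ z : V, s (z + fun _ => 1) = s z) ∧
    (∀ (z : V) (j : Fin 3), s (z + Pi.single j (τ j : ℂ)) =
      Complex.exp (-(Real.pi * Complex.I * τ j) - 2 * Real.pi * Complex.I * z j) * s z)}
  zero_mem' := by
    refine ⟨differentiable_const _, ?_, ?_, ?_⟩ <;> intros <;> simp
  add_mem' := by
    rintro s t ⟨hs, hs1, hs2, hs3⟩ ⟨ht, ht1, ht2, ht3⟩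
    refine ⟨hs.add ht, fun z j => ?_, fun z => ?_, fun z j => ?_⟩
    · simp only [Pi.add_apply, hs1, ht1]
    · simp only [Pi.add_apply, hs2, ht2]
    · simp only [Pi.add_apply, hs3, ht3, mul_add]
  smul_mem' := by
    rintro a s ⟨hs, hs1, hs2, hs3⟩
    refine ⟨hs.const_smul a, fun z j => ?_, fun z => ?_, fun z j => ?_⟩
    · simp only [Pi.smul_apply, hs1]
    · simp only [Pi.smul_apply, hs2]
    · simp only [Pi.smul_apply, hs3, smul_eq_mul, mul_left_comm]

/-- `𝓑(𝓛)`: the set of base points of `|𝓛|`, that is, the points of `A` at which every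
section of `𝓛` vanishes. -/
def baseLocus (τ : Fin 3 → UpperHalfPlane) : Set (Threefold τ) :=
  {P | ∀ s ∈ sections τ, ∀ z : V, proj τ z = P → s z = 0}

/-! ### The surface -/

/-- The theta functions of one variable spanning `H⁰(E, 𝓞_E(2 O_E))`, `E = ℂ / ⟨2, t⟩`:
`θ₀(z) = ∑ₙ exp (π i n² t + 2 π i n z)` is invariant under `z ↦ z + 1`, and
`θ₁(z) = exp (π i t / 4 + π i z) θ₀(z + t / 2)` is anti-invariant. -/
def theta (h : Fin 2) (z t : ℂ) : ℂ :=
  if h = 0 then jacobiTheta₂ z t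
  else Complex.exp (Real.pi * Complex.I * t / 4 + Real.pi * Complex.I * z) *
    jacobiTheta₂ (z + t / 2) t

/-- `θ_ijk (z) = θ_i (z₁, τ₁₁) θ_j (z₂, τ₂₂) θ_k (z₃, τ₃₃)`. -/
def theta3 (τ : Fin 3 → UpperHalfPlane) (i j k : Fin 2) (z : V) : ℂ :=
  theta i (z 0) (τ 0) * theta j (z 1) (τ 1) * theta k (z 2) (τ 2)

/-- `θ = θ₀₀₀ + b θ₀₁₁ + c θ₁₀₁ + d θ₁₁₀`. -/
def surfaceEq (τ : Fin 3 → UpperHalfPlane) (b c d : ℂ) (z : V) : ℂ :=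
  theta3 τ 0 0 0 z + b * theta3 τ 0 1 1 z + c * theta3 τ 1 0 1 z + d * theta3 τ 1 1 0 z

/-- The surface in `A` which is the zero locus of `θ`. -/
def surface (τ : Fin 3 → UpperHalfPlane) (b c d : ℂ) : Set (Threefold τ) :=
  proj τ '' {z | surfaceEq τ b c d z = 0}

/-- The divisor of `f` is smooth: the differential of `f` vanishes at no zero of `f`. -/
def IsSmoothDivisor (f : V → ℂ) : Prop :=
  ∀ z, f z = 0 → fderiv ℂ f z ≠ 0

/-! ### Holomorphic 2-forms on a hypersurface and the canonical map -/

/-- The tangent space at `z` of the hypersurface `f = 0`. -/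
def tangent (f : V → ℂ) (z : V) : Submodule ℂ V :=
  LinearMap.ker (fderiv ℂ f z : V →ₗ[ℂ] ℂ)

/-- `H⁰(S, ω_S)` for the smooth surface `S ⊆ A` whose preimage in `ℂ³` is `{f = 0}`: the
holomorphic 2-forms on `S`, given as 2-forms on `{f = 0}` which are holomorphic (locally the
restriction of a holomorphic 2-form of the ambient space) and invariant under the lattice. -/
def canonicalForms (τ : Fin 3 → UpperHalfPlane) (f : V → ℂ) :
    Submodule ℂ ((z : {z : V // f z = 0}) → (tangent f z.1) [⋀^Fin 2]→ₗ[ℂ] ℂ) where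
  carrier := {η |
    (∀ z : {z : V // f z = 0}, ∃ Ω : V → V [⋀^Fin 2]→L[ℂ] ℂ, AnalyticAt ℂ Ω z.1 ∧
      ∀ᶠ w in nhds z.1, ∀ (hw : f w = 0) (u : Fin 2 → tangent f w),
        η ⟨w, hw⟩ u = Ω w (fun i => (u i : V))) ∧
    (∀ z w : {z : V // f z = 0}, w.1 - z.1 ∈ lattice τ →
      ∀ (u : Fin 2 → tangent f z.1) (v : Fin 2 → tangent f w.1),
        (∀ i, (u i : V) = v i) → η w v = η z u)}
  zero_mem' := by
    refine ⟨fun z => ⟨fun _ => 0, analyticAt_const, ?_⟩, ?_⟩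
    · exact Filter.Eventually.of_forall fun w hw u => by simp
    · intro z w _ u v _
      simp
  add_mem' := by
    rintro η ζ ⟨hη, hη'⟩ ⟨hζ, hζ'⟩
    refine ⟨fun z => ?_, ?_⟩
    · obtain ⟨Ω, hΩ, h1⟩ := hη z
      obtain ⟨Ξ, hΞ, h2⟩ := hζ z
      refine ⟨fun w => Ω w + Ξ w, hΩ.add hΞ, ?_⟩
      filter_upwards [h1, h2] with w h1 h2 hw u
      simp [h1 hw u, h2 hw u]
    · intro z w h u v huv
      simp [hη' z w h u v huv, hζ' z w h u v huv]
  smul_mem' := by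
    rintro a η ⟨hη, hη'⟩
    refine ⟨fun z => ?_, ?_⟩
    · obtain ⟨Ω, hΩ, h1⟩ := hη z
      refine ⟨a • Ω, hΩ.const_smul, ?_⟩
      filter_upwards [h1] with w h1 hw u
      simp [h1 hw u]
    · intro z w h u v huv
      simp [hη' z w h u v huv]

/-- The canonical map of `S`, as a map to the projective space of hyperplanes of `H⁰(S, ω_S)`:
a point `P` goes to the space of the holomorphic 2-forms which vanish at `P`. This space is a
hyperplane if and only if `P` is not a base point of the canonical system. -/
def canonicalMap (τ : Fin 3 → UpperHalfPlane) (f : V → ℂ) (P : Threefold τ) :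
    Submodule ℂ (canonicalForms τ f) where
  carrier := {η | ∀ z : {z : V // f z = 0}, proj τ z.1 = P → η.1 z = 0}
  zero_mem' := fun _ _ => rfl
  add_mem' := by
    intro η ζ hη hζ z hz
    simp [hη z hz, hζ z hz]
  smul_mem' := by
    intro a η hη z hz
    simp [hη z hz]

end

end CanonicalMap122

namespace CanonicalMap122

open Complex

/-! Everything reduces to one variable. Fourier coefficients show that degree-one theta functions
are unique up to a scalar (`IsTheta.proportional`); comparison with a product gives the zeros of
`jacobiTheta₂` and their simplicity. So `θ₀` and `θ₁` have simple zeros, one class each modulo `1`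
and `τ`, and no zero in common.

Base points: translations by the `e_j` act on sections through `(ℤ/2)²`. An eigensection with signs
`(a + b, a, b)` vanishes wherever one coordinate is a zero of the corresponding `θ`. Hence the base
points are the points whose coordinates are zeros of `θ_{k 0}, θ_{k 1}, θ_{k 2}` with `k 0 = k 1 + k
2` (`eq_zero_of_hasType`, `exists_hasType`): four types, and four points of each type modulo the
lattice.

Smoothness: in each coordinate the equation has the form `θ₀ A + θ₁ B`, with `A`, `B` free of that
coordinate. At a singular point either `A = B = 0` or the Wronskian of `θ₀, θ₁` vanishes there, and
then `θ₁ / θ₀` lies in a finite set (`finite_branchValues`). Finitely many polynomial conditions on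
`(b, c, d)` thus exclude singular points (`SmoothCondition.isSmoothDivisor`).

Canonical map: the form `det (v, ·, ·)` vanishes on a tangent plane exactly when `v` lies in that
plane, so the canonical map determines the Gauss map (`surfaceGrad_proportional`). At a base point
the gradient is, up to a scalar, a vector depending only on the type, with signs given by the
position within the type (`exists_surfaceGrad_baseRep`). Squared ratios of its entries separate the
types for general parameters; the signs separate points of one type. -/

/-! ### Infinite products -/

/-- The infinite product `∏ (1 + q ^ (2 n + 1) w)`. -/
noncomputable def oddProd (q w : ℂ) : ℂ := ∏' n : ℕ, (1 + q ^ (2 * n + 1) * w)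

lemma summable_norm_odd_pow {q : ℂ} (hq : ‖q‖ < 1) (w : ℂ) :
    Summable fun n : ℕ => ‖q ^ (2 * n + 1) * w‖ := by
  simp_rw [norm_mul, norm_pow]
  refine Summable.mul_right _ ?_
  have h := summable_geometric_of_lt_one (norm_nonneg q) hq
  exact h.comp_injective (i := fun n : ℕ => 2 * n + 1) fun a b h => by simpa using h

lemma oddProd_eq {q : ℂ} (hq : ‖q‖ < 1) (w : ℂ) :
    oddProd q w = (1 + q * w) * oddProd q (q ^ 2 * w) := by
  have h := multipliable_one_add_of_summable (summable_norm_odd_pow hq w)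
  have h' := multipliable_one_add_of_summable (summable_norm_odd_pow hq (q ^ 2 * w))
  have e : ∀ n : ℕ, 1 + q ^ (2 * n + 1) * (q ^ 2 * w) = 1 + q ^ (2 * (n + 1) + 1) * w :=
    fun n => by ring
  simp_rw [e] at h'
  unfold oddProd
  simp_rw [e]
  rw [tprod_eq_zero_mul' (f := fun n : ℕ => 1 + q ^ (2 * n + 1) * w) h']
  simp

lemma oddProd_eq_zero_iff {q : ℂ} (hq : ‖q‖ < 1) (w : ℂ) :
    oddProd q w = 0 ↔ ∃ n : ℕ, 1 + q ^ (2 * n + 1) * w = 0 := by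
  constructor
  · intro h
    by_contra! hne
    exact tprod_one_add_ne_zero_of_summable hne (summable_norm_odd_pow hq w) h
  · rintro ⟨n, hn⟩
    exact tprod_of_exists_eq_zero ⟨n, hn⟩

lemma differentiable_oddProd {q : ℂ} (hq : ‖q‖ < 1) : Differentiable ℂ (oddProd q) := by
  intro w₀
  have hB : Metric.ball (0 : ℂ) (‖w₀‖ + 1) ∈ nhds w₀ :=
    Metric.isOpen_ball.mem_nhds (by simp)
  refine DifferentiableOn.differentiableAt ?_ hB
  have := Summable.hasProdLocallyUniformlyOn_nat_one_add (K := Metric.ball (0 : ℂ) (‖w₀‖ + 1))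
    (f := fun (n : ℕ) w => q ^ (2 * n + 1) * w) (u := fun n => ‖q ^ (2 * n + 1) * (‖w₀‖ + 1 : ℝ)‖)
    Metric.isOpen_ball (summable_norm_odd_pow hq _) (.of_forall fun n x hx => by
      rw [norm_mul, norm_mul]
      gcongr
      rw [Complex.norm_of_nonneg (by positivity)]
      exact (mem_ball_zero_iff.1 hx).le) (fun n => by fun_prop)
  exact this.differentiableOn
    (.of_forall fun _ ↦ by simpa [Finset.prod_fn] using
      DifferentiableOn.finsetProd (fun _ _ ↦ by fun_prop)) Metric.isOpen_ball

/-! ### Uniqueness of theta functions of degree one -/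

/-- A theta function of degree one: an entire function with the periods and the factor of
automorphy of `jacobiTheta₂ · t`. -/
structure IsTheta (t : ℂ) (f : ℂ → ℂ) : Prop where
  differentiable : Differentiable ℂ f
  add_one : ∀ z, f (z + 1) = f z
  add_tau : ∀ z, f (z + t) = exp (-(Real.pi * I * t) - 2 * Real.pi * I * z) * f z

/-- The `n`-th Fourier coefficient of `f`, computed on the line through `w`. -/
noncomputable def lineCoeff (f : ℂ → ℂ) (n : ℤ) (w : ℂ) : ℂ :=
  ∫ x in (0 : ℝ)..1, f (x + w) * exp (-(2 * Real.pi * I * n * (x + w)))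

lemma exp_int_period (n : ℤ) (z : ℂ) :
    exp (-(2 * Real.pi * I * n * (z + 1))) = exp (-(2 * Real.pi * I * n * z)) := by
  rw [Complex.exp_eq_exp_iff_exists_int]
  exact ⟨-n, by push_cast; ring⟩

/-- With an entire primitive `G` the integral is `G (w + 1) - G w`, whose derivative in `w` is zero
by periodicity. -/
lemma integral_line_eq {g : ℂ → ℂ} (hg : Differentiable ℂ g) (h1 : ∀ z, g (z + 1) = g z)
    (w : ℂ) : ∫ x in (0 : ℝ)..1, g (x + w) = ∫ x in (0 : ℝ)..1, g x := by
  obtain ⟨G, hG⟩ := hg.isExactOn_univ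
  have key : ∀ w : ℂ, ∫ x in (0 : ℝ)..1, g (x + w) = G (w + 1) - G w := by
    intro w
    rw [intervalIntegral.integral_eq_sub_of_hasDerivAt (f := fun x : ℝ => G (x + w))]
    · simp [add_comm]
    · intro x _
      have := (hG (x + w) (Set.mem_univ _)).comp_add_const (x : ℂ) w
      exact this.comp_ofReal
    · exact (hg.continuous.comp
        (by fun_prop : Continuous fun x : ℝ => (x + w : ℂ))).intervalIntegrable _ _
  have hd : ∀ z, HasDerivAt (fun z => G (z + 1) - G z) 0 z := fun z => by
    have := ((hG (z + 1) (Set.mem_univ _)).comp_add_const z 1).sub (hG z (Set.mem_univ _))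
    rwa [h1, sub_self] at this
  have hc := is_const_of_deriv_eq_zero (fun z => (hd z).differentiableAt) (fun z => (hd z).deriv) w 0
  have h0 := key 0
  simp only [add_zero] at h0
  rw [key, h0]
  simpa using hc

lemma lineCoeff_eq {f : ℂ → ℂ} (hf : Differentiable ℂ f) (h1 : ∀ z, f (z + 1) = f z) (n : ℤ)
    (w : ℂ) : lineCoeff f n w = lineCoeff f n 0 := by
  have := integral_line_eq (g := fun z => f z * exp (-(2 * Real.pi * I * n * z)))
    (by fun_prop) (fun z => by simp only [h1, exp_int_period]) w
  simpa [lineCoeff] using this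

/-- Computing the coefficient on the line through `t` instead of `0` brings in the factor of
automorphy, whose `exp (-2πiz)` raises the frequency by one. -/
lemma IsTheta.lineCoeff_succ {t : ℂ} {f : ℂ → ℂ} (hf : IsTheta t f) (n : ℤ) :
    lineCoeff f n 0 = exp (-(Real.pi * I * t) - 2 * Real.pi * I * n * t) *
      lineCoeff f (n + 1) 0 := by
  rw [← lineCoeff_eq hf.differentiable hf.add_one n t, lineCoeff, lineCoeff,
    ← intervalIntegral.integral_const_mul]
  refine intervalIntegral.integral_congr fun x _ => ?_
  simp only [hf.add_tau, add_zero]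
  rw [mul_right_comm, ← Complex.exp_add, mul_left_comm, ← Complex.exp_add, mul_comm (f x)]
  congr 2
  push_cast
  ring

lemma IsTheta.lineCoeff_eq_zero {t : ℂ} {f : ℂ → ℂ} (hf : IsTheta t f)
    (h0 : lineCoeff f 0 0 = 0) (n : ℤ) : lineCoeff f n 0 = 0 := by
  induction n using Int.induction_on with
  | zero => exact h0
  | succ n ih =>
    rw [hf.lineCoeff_succ] at ih
    exact (mul_eq_zero.1 ih).resolve_left (Complex.exp_ne_zero _)
  | pred n ih =>
    rw [hf.lineCoeff_succ, sub_add_cancel, ih, mul_zero]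

/-- The Fourier series forces `f = 0` on the real line, and the identity theorem does the rest. -/
lemma eq_zero_of_lineCoeff {f : ℂ → ℂ} (hf : Differentiable ℂ f) (h1 : ∀ z, f (z + 1) = f z)
    (h0 : ∀ n, lineCoeff f n 0 = 0) : f = 0 := by
  have hp : Function.Periodic (fun x : ℝ => f x) 1 := fun x => by simp [h1]
  have hc : Continuous hp.lift := by
    refine continuous_coinduced_dom.2 ?_
    exact hf.continuous.comp Complex.continuous_ofReal
  let F : C(AddCircle (1 : ℝ), ℂ) := ⟨hp.lift, hc⟩
  have hF : fourierCoeff F = 0 := by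
    funext n
    rw [fourierCoeff_eq_intervalIntegral _ n 0, Pi.zero_apply, ← h0 n, lineCoeff]
    simp only [zero_add, div_one, one_smul]
    refine intervalIntegral.integral_congr fun x _ => ?_
    simp only [F, ContinuousMap.coe_mk, Function.Periodic.lift_coe, fourier_coe_apply, smul_eq_mul,
      add_zero]
    rw [mul_comm]
    congr 2
    push_cast
    ring
  have hx : ∀ x : ℝ, f x = 0 := fun x => by
    have := has_pointwise_sum_fourier_series_of_summable (f := F) (by rw [hF]; exact summable_zero) x
    simp only [hF, Pi.zero_apply, zero_smul] at this
    exact this.unique hasSum_zero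
  have hA : AnalyticOnNhd ℂ f Set.univ := fun z _ => hf.analyticAt z
  have := hA.eqOn_zero_of_preconnected_of_frequently_eq_zero isPreconnected_univ (Set.mem_univ 0) ?_
  · funext z; exact this (Set.mem_univ z)
  · have ht : Filter.Tendsto (fun x : ℝ => (x : ℂ)) (nhdsWithin 0 {0}ᶜ) (nhdsWithin 0 {0}ᶜ) :=
      tendsto_nhdsWithin_of_tendsto_nhds_of_eventually_within _
        (Complex.continuous_ofReal.tendsto' 0 0 (by simp) |>.mono_left nhdsWithin_le_nhds)
        (by filter_upwards [self_mem_nhdsWithin] with x hx; simpa using hx)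
    exact ht.frequently (Filter.Eventually.of_forall hx).frequently

lemma IsTheta.const_mul {t : ℂ} {f : ℂ → ℂ} (hf : IsTheta t f) (c : ℂ) :
    IsTheta t (fun z => c * f z) where
  differentiable := hf.differentiable.const_mul c
  add_one z := by simp only [hf.add_one]
  add_tau z := by simp only [hf.add_tau]; ring

lemma IsTheta.sub {t : ℂ} {f g : ℂ → ℂ} (hf : IsTheta t f) (hg : IsTheta t g) :
    IsTheta t (fun z => f z - g z) where
  differentiable := hf.differentiable.sub hg.differentiable
  add_one z := by simp only [hf.add_one, hg.add_one]
  add_tau z := by simp only [hf.add_tau, hg.add_tau]; ring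

lemma IsTheta.eq_zero {t : ℂ} {f : ℂ → ℂ} (hf : IsTheta t f) (h0 : lineCoeff f 0 0 = 0) : f = 0 :=
  eq_zero_of_lineCoeff hf.differentiable hf.add_one (hf.lineCoeff_eq_zero h0)

lemma IsTheta.proportional {t : ℂ} {f g : ℂ → ℂ} (hf : IsTheta t f) (hg : IsTheta t g)
    (hg0 : ∃ z, g z ≠ 0) : ∃ c, ∀ z, f z = c * g z := by
  have h0 : lineCoeff g 0 0 ≠ 0 := fun h => by
    obtain ⟨z, hz⟩ := hg0
    exact hz (congrFun (hg.eq_zero h) z)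
  refine ⟨lineCoeff f 0 0 / lineCoeff g 0 0, fun z => ?_⟩
  have := (hf.sub (hg.const_mul (lineCoeff f 0 0 / lineCoeff g 0 0))).eq_zero ?_
  · exact sub_eq_zero.1 (congrFun this z)
  · have hfc := hf.differentiable.continuous
    have hgc := hg.differentiable.continuous
    have : lineCoeff (fun z => f z - lineCoeff f 0 0 / lineCoeff g 0 0 * g z) 0 0 =
        lineCoeff f 0 0 - lineCoeff f 0 0 / lineCoeff g 0 0 * lineCoeff g 0 0 := by
      simp only [lineCoeff, Int.cast_zero, mul_zero, zero_mul, neg_zero, Complex.exp_zero,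
        mul_one, add_zero]
      rw [intervalIntegral.integral_sub, intervalIntegral.integral_const_mul]
      · exact (hfc.comp Complex.continuous_ofReal).intervalIntegrable _ _
      · exact ((hgc.comp Complex.continuous_ofReal).const_mul _).intervalIntegrable _ _
    rw [this, div_mul_cancel₀ _ h0, sub_self]

/-! ### The product formula -/

/-- The product in the Jacobi triple product formula, without the constant. -/
noncomputable def thetaProd (t z : ℂ) : ℂ :=
  oddProd (exp (Real.pi * I * t)) (exp (2 * Real.pi * I * z)) *
    oddProd (exp (Real.pi * I * t)) (exp (-(2 * Real.pi * I * z)))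

lemma norm_nome_lt_one {t : ℂ} (ht : 0 < t.im) : ‖exp (Real.pi * I * t)‖ < 1 := by
  rw [Complex.norm_exp, Real.exp_lt_one_iff]
  simp only [mul_re, ofReal_re, I_re, mul_zero, ofReal_im, I_im, mul_one, sub_self, zero_mul,
    mul_im, add_zero, zero_sub]
  nlinarith [Real.pi_pos]

lemma isTheta_thetaProd {t : ℂ} (ht : 0 < t.im) : IsTheta t (thetaProd t) where
  differentiable := by
    have := differentiable_oddProd (norm_nome_lt_one ht)
    unfold thetaProd
    fun_prop
  add_one z := by
    have h1 : exp (2 * Real.pi * I * (z + 1)) = exp (2 * Real.pi * I * z) :=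
      Complex.exp_eq_exp_iff_exists_int.2 ⟨1, by push_cast; ring⟩
    simp only [thetaProd, Complex.exp_neg, h1]
  add_tau z := by
    have hq := norm_nome_lt_one ht
    set q := exp (Real.pi * I * t) with hqdef
    set w := exp (2 * Real.pi * I * z) with hw
    have hq0 : q ≠ 0 := Complex.exp_ne_zero _
    have hw0 : w ≠ 0 := Complex.exp_ne_zero _
    have h1 : exp (2 * Real.pi * I * (z + t)) = q ^ 2 * w := by
      rw [hqdef, hw, ← Complex.exp_nat_mul, ← Complex.exp_add]
      congr 1; push_cast; ring
    have h2 : exp (-(Real.pi * I * t) - 2 * Real.pi * I * z) = (q * w)⁻¹ := by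
      rw [hqdef, hw, ← Complex.exp_add, ← Complex.exp_neg]
      congr 1; ring
    simp only [thetaProd, Complex.exp_neg, h1, h2, ← hqdef, ← hw]
    -- Under `w ↦ q² w` the first product loses the factor `1 + q w` and the second gains `1 + (q
    -- w)⁻¹`; their quotient is `(q w)⁻¹`.
    rw [oddProd_eq hq w, oddProd_eq hq (q ^ 2 * w)⁻¹]
    have h3 : q ^ 2 * (q ^ 2 * w)⁻¹ = w⁻¹ := by field_simp
    rw [h3]
    field_simp
    ring

lemma isTheta_jacobiTheta₂ {t : ℂ} (ht : 0 < t.im) : IsTheta t (jacobiTheta₂ · t) where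
  differentiable z := differentiableAt_jacobiTheta₂_fst z ht
  add_one z := jacobiTheta₂_add_left z t
  add_tau z := by
    rw [jacobiTheta₂_add_left']
    congr 2; ring

lemma thetaProd_eq_zero_iff {t : ℂ} (ht : 0 < t.im) (z : ℂ) :
    thetaProd t z = 0 ↔ ∃ m n : ℤ, z = 1 / 2 + t / 2 + m + n * t := by
  have hq := norm_nome_lt_one ht
  have key : ∀ (u : ℂ) (n : ℕ), 1 + exp (Real.pi * I * t) ^ (2 * n + 1) *
      exp (2 * Real.pi * I * u) = 0 ↔ ∃ m : ℤ, u = 1 / 2 + m - (2 * n + 1) * (t / 2) := by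
    intro u n
    rw [← Complex.exp_nat_mul, ← Complex.exp_add, add_comm, add_eq_zero_iff_eq_neg,
      ← Complex.exp_pi_mul_I, Complex.exp_eq_exp_iff_exists_int]
    refine exists_congr fun m => ?_
    have hp : (2 * Real.pi * I : ℂ) ≠ 0 := Complex.two_pi_I_ne_zero
    rw [← sub_eq_zero, ← sub_eq_zero (a := u)]
    rw [← mul_right_inj' hp (b := u - _) (c := 0), mul_zero]
    push_cast
    ring_nf
  rw [thetaProd, mul_eq_zero, oddProd_eq_zero_iff hq, oddProd_eq_zero_iff hq]
  simp_rw [← mul_neg _ z, key]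
  constructor
  -- The first product carries the zeros with negative coefficient of `t`, the second those with
  -- nonnegative coefficient.
  · rintro (⟨n, m, h⟩ | ⟨n, m, h⟩)
    · exact ⟨m, -(n + 1), by rw [h]; push_cast; ring⟩
    · exact ⟨-m - 1, n, by rw [← neg_neg z, h]; push_cast; ring⟩
  · rintro ⟨m, n, h⟩
    rcases lt_or_ge n 0 with hn | hn
    · lift -n - 1 to ℕ using by omega with k hk
      refine Or.inl ⟨k, m, ?_⟩
      have hk' : (k : ℂ) = -n - 1 := by exact_mod_cast congrArg (Int.cast : ℤ → ℂ) hk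
      rw [h, hk']; ring
    · lift n to ℕ using hn
      exact Or.inr ⟨n, -m - 1, by rw [h]; push_cast; ring⟩

/-- Exactly one factor, `1 + q / w`, vanishes at this point, where `w = -q`, and it does so simply.
The cofactor there is `oddProd q (-q) ^ 2`, with factors `1 - q ^ (2 n + 2) ≠ 0`. -/
lemma deriv_thetaProd_ne_zero {t : ℂ} (ht : 0 < t.im) :
    deriv (thetaProd t) (1 / 2 + t / 2) ≠ 0 := by
  have hq := norm_nome_lt_one ht
  set q := exp (Real.pi * I * t) with hqdef
  set p : ℂ := 1 / 2 + t / 2 with hp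
  have hd := differentiable_oddProd hq
  have hq0 : q ≠ 0 := Complex.exp_ne_zero _
  have hw : exp (2 * Real.pi * I * p) = -q := by
    rw [hqdef, hp, ← neg_one_mul, ← Complex.exp_pi_mul_I, ← Complex.exp_add]
    congr 1; ring
  have hA : oddProd q (-q) ≠ 0 := by
    rw [Ne, oddProd_eq_zero_iff hq]
    rintro ⟨n, hn⟩
    have : q ^ (2 * n + 2) = 1 := by linear_combination -hn
    have h2 := congrArg norm this
    rw [norm_pow, norm_one] at h2
    exact (pow_lt_one₀ (norm_nonneg _) hq (by omega)).ne h2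
  have hf : thetaProd t = fun z => (1 + q * exp (-(2 * Real.pi * I * z))) *
      (oddProd q (exp (2 * Real.pi * I * z)) *
        oddProd q (q ^ 2 * exp (-(2 * Real.pi * I * z)))) := by
    funext z
    rw [thetaProd, oddProd_eq hq (exp (-(2 * Real.pi * I * z)))]
    ring
  have h1 : HasDerivAt (fun z : ℂ => 1 + q * exp (-(2 * Real.pi * I * z)))
      (q * (exp (-(2 * Real.pi * I * p)) * -(2 * Real.pi * I))) p := by
    have := ((((hasDerivAt_id p).const_mul (2 * Real.pi * I)).neg.cexp).const_mul q).const_add 1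
    simpa using this
  have h2 : DifferentiableAt ℂ (fun z => oddProd q (exp (2 * Real.pi * I * z)) *
        oddProd q (q ^ 2 * exp (-(2 * Real.pi * I * z)))) p := by fun_prop
  rw [hf, (h1.fun_mul h2.hasDerivAt).deriv, Complex.exp_neg, hw]
  have e1 : 1 + q * (-q)⁻¹ = 0 := by field_simp; ring
  have e2 : q ^ 2 * (-q)⁻¹ = -q := by field_simp
  rw [e1, e2, zero_mul, add_zero]
  refine mul_ne_zero (mul_ne_zero hq0 (mul_ne_zero (by simpa using hq0) ?_)) (mul_ne_zero hA hA)
  exact neg_ne_zero.2 Complex.two_pi_I_ne_zero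

/-- Termwise integration over `[0, 1]` gives constant Fourier coefficient `1`. -/
lemma exists_jacobiTheta₂_ne_zero {t : ℂ} (ht : 0 < t.im) : ∃ z, jacobiTheta₂ z t ≠ 0 := by
  by_contra! h
  have hn : ∀ (n : ℤ) (x : ℝ), ‖jacobiTheta₂_term n x t‖ = ‖jacobiTheta₂_term n 0 t‖ := by
    simp [norm_jacobiTheta₂_term]
  have hc : ∀ n : ℤ, Continuous fun x : ℝ => jacobiTheta₂_term n x t := fun n => by
    unfold jacobiTheta₂_term; fun_prop
  have h1 := intervalIntegral.hasSum_integral_of_dominated_convergence (μ := MeasureTheory.volume)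
    (a := 0) (b := 1) (F := fun (n : ℤ) (x : ℝ) => jacobiTheta₂_term n x t)
    (f := fun x => jacobiTheta₂ x t) (fun n _ => ‖jacobiTheta₂_term n 0 t‖)
    (fun n => (hc n).aestronglyMeasurable)
    (fun n => .of_forall fun x _ => (hn n x).le)
    (.of_forall fun x _ => ((summable_jacobiTheta₂_term_iff 0 t).2 ht).norm)
    (by simp)
    (.of_forall fun x _ => hasSum_jacobiTheta₂_term x ht)
  have h2 : ∀ n : ℤ, ∫ x in (0 : ℝ)..1, jacobiTheta₂_term n x t = if n = 0 then 1 else 0 := by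
    intro n
    split_ifs with h0
    · simp [h0, jacobiTheta₂_term]
    · have hne : (2 * Real.pi * I * n : ℂ) ≠ 0 :=
        mul_ne_zero Complex.two_pi_I_ne_zero (Int.cast_ne_zero.2 h0)
      have h3 : exp (2 * Real.pi * I * n * (1 : ℝ)) = 1 :=
        Complex.exp_eq_one_iff.2 ⟨n, by push_cast; ring⟩
      simp only [jacobiTheta₂_term, Complex.exp_add]
      rw [intervalIntegral.integral_mul_const, integral_exp_mul_complex hne, h3]
      simp
  simp only [h2, h, intervalIntegral.integral_zero] at h1
  exact one_ne_zero ((hasSum_ite_eq (0 : ℤ) (1 : ℂ)).unique h1)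

/-- **Jacobi triple product**, up to the value of the constant. -/
lemma exists_jacobiTheta₂_eq_thetaProd {t : ℂ} (ht : 0 < t.im) :
    ∃ c ≠ 0, ∀ z, jacobiTheta₂ z t = c * thetaProd t z := by
  obtain ⟨z₀, hz₀⟩ := exists_jacobiTheta₂_ne_zero ht
  have hP : ∃ z, thetaProd t z ≠ 0 := by
    by_contra! h
    exact deriv_thetaProd_ne_zero ht (by rw [funext h]; simp)
  obtain ⟨c, hc⟩ := (isTheta_jacobiTheta₂ ht).proportional (isTheta_thetaProd ht) hP
  exact ⟨c, fun h => hz₀ (by rw [hc, h, zero_mul]), hc⟩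

lemma jacobiTheta₂_eq_zero_iff {t : ℂ} (ht : 0 < t.im) (z : ℂ) :
    jacobiTheta₂ z t = 0 ↔ ∃ m n : ℤ, z = 1 / 2 + t / 2 + m + n * t := by
  obtain ⟨c, hc, h⟩ := exists_jacobiTheta₂_eq_thetaProd ht
  rw [h, mul_eq_zero, or_iff_right hc, thetaProd_eq_zero_iff ht]

lemma deriv_jacobiTheta₂_ne_zero {t : ℂ} (ht : 0 < t.im) :
    deriv (jacobiTheta₂ · t) (1 / 2 + t / 2) ≠ 0 := by
  obtain ⟨c, hc, h⟩ := exists_jacobiTheta₂_eq_thetaProd ht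
  rw [funext h, deriv_const_mul_field]
  exact mul_ne_zero hc (deriv_thetaProd_ne_zero ht)

lemma IsTheta.eq_zero_of_jacobiTheta₂ {t : ℂ} (ht : 0 < t.im) {f : ℂ → ℂ} (hf : IsTheta t f)
    {z : ℂ} (hz : jacobiTheta₂ z t = 0) : f z = 0 := by
  obtain ⟨c, hc⟩ := hf.proportional (isTheta_jacobiTheta₂ ht) (exists_jacobiTheta₂_ne_zero ht)
  rw [hc, hz, mul_zero]

/-! ### The functions `θ₀` and `θ₁` -/

/-- The factor of automorphy of `θ₀` and `θ₁` for the period `t`. -/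
noncomputable def autFactor (t z : ℂ) : ℂ := exp (-(Real.pi * I * t) - 2 * Real.pi * I * z)

lemma autFactor_ne_zero (t z : ℂ) : autFactor t z ≠ 0 := Complex.exp_ne_zero _

lemma hasDerivAt_autFactor (t z : ℂ) :
    HasDerivAt (autFactor t) (autFactor t z * -(2 * Real.pi * I)) z := by
  have := (((hasDerivAt_id z).const_mul (2 * Real.pi * I)).const_sub (-(Real.pi * I * t))).cexp
  simpa [autFactor] using! this

lemma theta_zero (z t : ℂ) : theta 0 z t = jacobiTheta₂ z t := if_pos rfl

lemma theta_one (z t : ℂ) : theta 1 z t =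
    exp (Real.pi * I * t / 4 + Real.pi * I * z) * jacobiTheta₂ (z + t / 2) t := if_neg (by decide)

lemma differentiable_theta {t : ℂ} (ht : 0 < t.im) (h : Fin 2) :
    Differentiable ℂ (theta h · t) := by
  have hd := (isTheta_jacobiTheta₂ ht).differentiable
  fin_cases h
  · simpa only [Fin.zero_eta, theta_zero] using hd
  · have h1 : Differentiable ℂ fun z : ℂ => jacobiTheta₂ (z + t / 2) t :=
      hd.comp (differentiable_id.add_const (t / 2))
    simp only [Fin.mk_one, theta_one]
    fun_prop

lemma theta_add_one (h : Fin 2) (z t : ℂ) :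
    theta h (z + 1) t = (-1) ^ (h : ℕ) * theta h z t := by
  fin_cases h
  · simp [theta_zero, jacobiTheta₂_add_left]
  · have e : exp (Real.pi * I * t / 4 + Real.pi * I * (z + 1)) =
        -exp (Real.pi * I * t / 4 + Real.pi * I * z) := by
      rw [← neg_one_mul, ← Complex.exp_pi_mul_I, ← Complex.exp_add]
      congr 1; ring
    simp only [Fin.mk_one, theta_one, e, add_right_comm z 1, jacobiTheta₂_add_left]
    simp

lemma theta_add_tau (h : Fin 2) (z t : ℂ) :
    theta h (z + t) t = autFactor t z * theta h z t := by
  fin_cases h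
  · simp only [Fin.zero_eta, theta_zero, jacobiTheta₂_add_left', autFactor]
    congr 2; ring
  · simp only [Fin.mk_one, theta_one, add_right_comm z t, jacobiTheta₂_add_left', autFactor]
    rw [← mul_assoc, ← mul_assoc, ← Complex.exp_add, ← Complex.exp_add]
    congr 2; ring

/-- A zero of `θ_h`. -/
noncomputable def root (h : Fin 2) (t : ℂ) : ℂ := if h = 0 then 1 / 2 + t / 2 else 1 / 2

lemma root_zero (t : ℂ) : root 0 t = 1 / 2 + t / 2 := if_pos rfl

lemma root_one (t : ℂ) : root 1 t = 1 / 2 := if_neg (by decide)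

lemma theta_eq_zero_iff {t : ℂ} (ht : 0 < t.im) (h : Fin 2) (z : ℂ) :
    theta h z t = 0 ↔ ∃ m n : ℤ, z = root h t + m + n * t := by
  fin_cases h
  · simp only [Fin.zero_eta, theta_zero, root_zero, jacobiTheta₂_eq_zero_iff ht]
  · simp only [Fin.mk_one, theta_one, root_one, mul_eq_zero, Complex.exp_ne_zero, false_or,
      jacobiTheta₂_eq_zero_iff ht]
    refine exists_congr fun m => exists_congr fun n => ?_
    rw [← sub_eq_zero, ← sub_eq_zero (a := z)]
    ring_nf

lemma theta_root {t : ℂ} (ht : 0 < t.im) (h : Fin 2) : theta h (root h t) t = 0 :=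
  (theta_eq_zero_iff ht h _).2 ⟨0, 0, by simp⟩

/-- The two roots differ by `t / 2`, whose imaginary part is not an integral multiple of that of
`t`. -/
lemma root_eq_of_sub_eq {t : ℂ} (ht : 0 < t.im) {h k : Fin 2} {m n : ℤ}
    (e : root h t - root k t = m + n * t) : h = k := by
  have him := congrArg Complex.im e
  fin_cases h <;> fin_cases k <;> simp [root_zero, root_one] at him ⊢
  · have : (1 - 2 * n : ℝ) * t.im = 0 := by linarith
    rcases mul_eq_zero.1 this with h | h
    · have : (1 - 2 * n : ℤ) = 0 := by exact_mod_cast h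
      omega
    · exact ht.ne' h
  · have : (1 + 2 * n : ℝ) * t.im = 0 := by linarith
    rcases mul_eq_zero.1 this with h | h
    · have : (1 + 2 * n : ℤ) = 0 := by exact_mod_cast h
      omega
    · exact ht.ne' h

lemma eq_of_theta_eq_zero {t : ℂ} (ht : 0 < t.im) {h k : Fin 2} {z : ℂ}
    (hh : theta h z t = 0) (hk : theta k z t = 0) : h = k := by
  obtain ⟨m, n, e⟩ := (theta_eq_zero_iff ht h z).1 hh
  obtain ⟨m', n', e'⟩ := (theta_eq_zero_iff ht k z).1 hk
  refine root_eq_of_sub_eq ht (m := m' - m) (n := n' - n) ?_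
  push_cast
  linear_combination e' - e

lemma deriv_theta_root_ne_zero {t : ℂ} (ht : 0 < t.im) (h : Fin 2) :
    deriv (theta h · t) (root h t) ≠ 0 := by
  fin_cases h
  · simpa only [Fin.zero_eta, theta_zero, root_zero] using deriv_jacobiTheta₂_ne_zero ht
  · simp only [Fin.mk_one, theta_one, root_one]
    have hd := (isTheta_jacobiTheta₂ ht).differentiable
    have h1 : HasDerivAt (fun z : ℂ => jacobiTheta₂ (z + t / 2) t)
        (deriv (jacobiTheta₂ · t) (1 / 2 + t / 2)) (1 / 2) :=
      (hd _).hasDerivAt.comp_add_const _ _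
    have h2 : DifferentiableAt ℂ (fun z : ℂ => exp (Real.pi * I * t / 4 + Real.pi * I * z))
      (1 / 2) := by fun_prop
    rw [(h2.hasDerivAt.fun_mul h1).deriv,
      (jacobiTheta₂_eq_zero_iff ht _).2 ⟨0, 0, by simp⟩, mul_zero, zero_add]
    exact mul_ne_zero (Complex.exp_ne_zero _) (deriv_jacobiTheta₂_ne_zero ht)

/-- An entire function with the functional equations of `θ_h` vanishes at the zeros of `θ_h`. -/
lemma eq_zero_of_theta_eq_zero {t : ℂ} (ht : 0 < t.im) {h : Fin 2} {f : ℂ → ℂ}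
    (hf : Differentiable ℂ f) (h1 : ∀ z, f (z + 1) = (-1) ^ (h : ℕ) * f z)
    (h2 : ∀ z, f (z + t) = autFactor t z * f z) {z : ℂ} (hz : theta h z t = 0) : f z = 0 := by
  fin_cases h
  · refine IsTheta.eq_zero_of_jacobiTheta₂ ht ⟨hf, fun z => by simp [h1], h2⟩ ?_
    rwa [← theta_zero]
  · have hz' : jacobiTheta₂ (z + t / 2) t = 0 := by
      rw [Fin.mk_one, theta_one, mul_eq_zero] at hz
      exact hz.resolve_left (Complex.exp_ne_zero _)
    -- Undoing the half-period shift that defines `θ₁` turns `f` into a theta function of degree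
    -- one.
    have hg : IsTheta t fun w => exp (-(Real.pi * I * w)) * f (w - t / 2) := by
      refine ⟨by fun_prop, fun w => ?_, fun w => ?_⟩
      · have e : exp (-(Real.pi * I * (w + 1))) = -exp (-(Real.pi * I * w)) := by
          rw [← neg_one_mul (exp _), ← Complex.exp_pi_mul_I, ← Complex.exp_add,
            Complex.exp_eq_exp_iff_exists_int]
          exact ⟨-1, by push_cast; ring⟩
        rw [e, add_sub_right_comm, h1]
        simp
      · rw [add_sub_right_comm, h2, autFactor, ← mul_assoc, ← mul_assoc, ← Complex.exp_add,
          ← Complex.exp_add]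
        congr 2; ring
    have := hg.eq_zero_of_jacobiTheta₂ ht hz'
    simpa [Complex.exp_ne_zero] using this

/-! ### The Wronskian -/

lemma deriv_theta_add_one {t : ℂ} (h : Fin 2) (z : ℂ) :
    deriv (theta h · t) (z + 1) = (-1) ^ (h : ℕ) * deriv (theta h · t) z := by
  rw [← deriv_comp_add_const, ← deriv_const_mul_field]
  simp only [theta_add_one]

lemma deriv_theta_add_tau {t : ℂ} (ht : 0 < t.im) (h : Fin 2) (z : ℂ) :
    deriv (theta h · t) (z + t) =
      autFactor t z * (deriv (theta h · t) z - 2 * Real.pi * I * theta h z t) := by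
  rw [← deriv_comp_add_const]
  simp only [theta_add_tau]
  rw [((hasDerivAt_autFactor t z).fun_mul (differentiable_theta ht h z).hasDerivAt).deriv]
  ring

/-- The Wronskian of `θ₀` and `θ₁`. -/
noncomputable def wronskian (t z : ℂ) : ℂ :=
  theta 0 z t * deriv (theta 1 · t) z - theta 1 z t * deriv (theta 0 · t) z

lemma differentiable_wronskian {t : ℂ} (ht : 0 < t.im) : Differentiable ℂ (wronskian t) := by
  have h0 := differentiable_theta ht 0
  have h1 := differentiable_theta ht 1
  have h0' := h0.deriv
  have h1' := h1.deriv
  unfold wronskian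
  fun_prop

lemma iff_add_zsmul {X : ℂ → Prop} {l : ℂ} (h : ∀ z, X (z + l) ↔ X z) (n : ℤ) (z : ℂ) :
    X (z + n * l) ↔ X z := by
  induction n using Int.induction_on with
  | zero => simp
  | succ n ih => rw [← ih, ← h (z + (n : ℤ) * l)]; push_cast; ring_nf
  | pred n ih => rw [← ih, ← h]; push_cast; ring_nf

lemma iff_add_lattice {t : ℂ} {X : ℂ → Prop} (h1 : ∀ z, X (z + 1) ↔ X z)
    (h2 : ∀ z, X (z + t) ↔ X z) (m n : ℤ) (z : ℂ) : X (z + m + n * t) ↔ X z := by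
  rw [iff_add_zsmul h2, ← mul_one (m : ℂ), iff_add_zsmul h1]

lemma wronskian_add_one (t z : ℂ) : wronskian t (z + 1) = -wronskian t z := by
  simp only [wronskian, theta_add_one, deriv_theta_add_one]
  simp
  ring

lemma wronskian_add_tau {t : ℂ} (ht : 0 < t.im) (z : ℂ) :
    wronskian t (z + t) = autFactor t z ^ 2 * wronskian t z := by
  simp only [wronskian, theta_add_tau, deriv_theta_add_tau ht]
  ring

lemma wronskian_eq_zero_iff {t : ℂ} (ht : 0 < t.im) (m n : ℤ) (z : ℂ) :
    wronskian t (z + m + n * t) = 0 ↔ wronskian t z = 0 :=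
  iff_add_lattice (X := fun z => wronskian t z = 0) (fun z => by simp [wronskian_add_one])
    (fun z => by simp [wronskian_add_tau ht, autFactor_ne_zero]) m n z

/-- One term drops out; the other is, up to sign, the nonzero derivative at a simple zero times the
value of the other theta function. -/
lemma wronskian_root_ne_zero {t : ℂ} (ht : 0 < t.im) (h : Fin 2) : wronskian t (root h t) ≠ 0 := by
  have hd := deriv_theta_root_ne_zero ht h
  have h0 := theta_root ht h
  have h1 : ∀ k, theta k (root h t) t = 0 → h = k := fun k hk => eq_of_theta_eq_zero ht h0 hk
  fin_cases h
  · have := mt (h1 1) (by decide)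
    simp_all [wronskian]
  · have := mt (h1 0) (by decide)
    simp_all [wronskian]

lemma theta_ne_zero_of_wronskian {t : ℂ} (ht : 0 < t.im) {z : ℂ} (hz : wronskian t z = 0)
    (h : Fin 2) : theta h z t ≠ 0 := by
  intro h0
  obtain ⟨m, n, rfl⟩ := (theta_eq_zero_iff ht h z).1 h0
  exact wronskian_root_ne_zero ht h ((wronskian_eq_zero_iff ht m n _).1 hz)

lemma exists_add_lattice_mem_parallelogram {t : ℂ} (ht : 0 < t.im) (z : ℂ) :
    ∃ (m n : ℤ) (w : ℂ), z = w + m + n * t ∧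
      w ∈ (fun p : ℝ × ℝ => (p.1 : ℂ) + p.2 * t) '' (Set.Icc 0 1 ×ˢ Set.Icc 0 1) := by
  set y : ℝ := z.im / t.im
  set x : ℝ := (z - y * t).re
  have hz : z = x + y * t := by
    apply Complex.ext
    · simp [x]
    · simp [y, ht.ne']
  refine ⟨⌊x⌋, ⌊y⌋, Int.fract x + Int.fract y * t, ?_, ⟨(Int.fract x, Int.fract y), ?_, rfl⟩⟩
  · conv_lhs => rw [hz, ← Int.floor_add_fract x, ← Int.floor_add_fract y]
    push_cast
    ring
  · exact ⟨⟨Int.fract_nonneg _, (Int.fract_lt_one _).le⟩,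
      ⟨Int.fract_nonneg _, (Int.fract_lt_one _).le⟩⟩

/-- The values of `θ₁ / θ₀` at the zeros of the Wronskian. -/
def branchValues (t : ℂ) : Set ℂ := {l | ∃ z, wronskian t z = 0 ∧ theta 1 z t / theta 0 z t = l}

lemma finite_branchValues {t : ℂ} (ht : 0 < t.im) : (branchValues t).Finite := by
  set K := (fun p : ℝ × ℝ => (p.1 : ℂ) + p.2 * t) '' (Set.Icc 0 1 ×ˢ Set.Icc 0 1) with hK
  have hKc : IsCompact K := (isCompact_Icc.prod isCompact_Icc).image (by fun_prop)
  have hfin : (K ∩ wronskian t ⁻¹' {0}).Finite := by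
    have hA : AnalyticOnNhd ℂ (wronskian t) Set.univ :=
      fun z _ => (differentiable_wronskian ht).analyticAt z
    by_contra hinf
    -- Infinitely many zeros in a compact parallelogram would accumulate and make the Wronskian
    -- identically zero.
    obtain ⟨x, -, hx⟩ := Set.Infinite.exists_accPt_of_subset_isCompact hinf hKc
      Set.inter_subset_left
    rw [accPt_iff_frequently_nhdsNE] at hx
    have := hA.eqOn_zero_of_preconnected_of_frequently_eq_zero isPreconnected_univ
      (Set.mem_univ x) (hx.mono fun y hy => hy.2)
    exact wronskian_root_ne_zero ht 0 (this (Set.mem_univ _))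
  set Y := (fun z => theta 1 z t / theta 0 z t) '' (K ∩ wronskian t ⁻¹' {0}) with hY
  have hYf : Y.Finite := hfin.image _
  -- Lattice translations change `θ₁ / θ₀` at most by a sign.
  refine (hYf.union (hYf.image Neg.neg)).subset ?_
  rintro l ⟨z, hz, rfl⟩
  obtain ⟨m, n, w, rfl, hw⟩ := exists_add_lattice_mem_parallelogram ht z
  have hmem : theta 1 w t / theta 0 w t ∈ Y :=
    ⟨w, ⟨hw, (wronskian_eq_zero_iff ht m n w).1 hz⟩, rfl⟩
  have hsq : (theta 1 (w + m + n * t) t / theta 0 (w + m + n * t) t) ^ 2 =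
      (theta 1 w t / theta 0 w t) ^ 2 := by
    refine (iff_add_lattice (X := fun z => (theta 1 z t / theta 0 z t) ^ 2 =
      (theta 1 w t / theta 0 w t) ^ 2) (fun z => ?_) (fun z => ?_) m n w).2 rfl
    · simp [theta_add_one, neg_div]
    · simp [theta_add_tau, mul_div_mul_left _ _ (autFactor_ne_zero t z)]
  rcases sq_eq_sq_iff_eq_or_eq_neg.1 hsq with h | h
  · exact Or.inl (h ▸ hmem)
  · exact Or.inr ⟨_, hmem, h.symm⟩

variable {τ : Fin 3 → UpperHalfPlane}

/-! ### Sections and the lattice -/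

lemma theta3_mem_sections {i j k : Fin 2} (h : i = j + k) : theta3 τ i j k ∈ sections τ := by
  have hd : ∀ (h : Fin 2) (l : Fin 3), Differentiable ℂ fun z : V => theta h (z l) (τ l) :=
    fun h l => (differentiable_theta (τ l).im_pos h).comp (differentiable_apply l)
  have h2 : ∀ (h : Fin 2) (z t : ℂ), theta h (z + 2) t = theta h z t := fun h z t => by
    rw [← one_add_one_eq_two, ← add_assoc, theta_add_one, theta_add_one, ← mul_assoc, ← mul_pow]
    simp
  refine ⟨((hd i 0).mul (hd j 1)).mul (hd k 2), fun z l => ?_, fun z => ?_, fun z l => ?_⟩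
  · fin_cases l <;> simp [theta3, h2]
  · subst h
    fin_cases j <;> fin_cases k <;> simp [theta3, theta_add_one]
  · have e := theta_add_tau
    simp only [autFactor] at e
    fin_cases l <;> simp [theta3, e] <;> ring

/-- Differentiability of the factor is kept so that tangent spaces at equivalent points can be
compared. -/
lemma exists_factor_of_mem_lattice {s : V → ℂ} (hs : s ∈ sections τ) {l : V}
    (hl : l ∈ lattice τ) :
    ∃ e : V → ℂ, Differentiable ℂ e ∧ (∀ z, e z ≠ 0) ∧ ∀ z, s (z + l) = e z * s z := by
  obtain ⟨-, h1, h2, h3⟩ := hs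
  induction hl using AddSubgroup.closure_induction with
  | mem x hx =>
    rcases hx with (⟨j, rfl⟩ | ⟨j, rfl⟩) | rfl
    · refine ⟨_, ?_, fun z => ?_, fun z => h3 z j⟩
      · fun_prop
      · exact Complex.exp_ne_zero _
    · exact ⟨fun _ => 1, differentiable_const _, fun _ => one_ne_zero, fun z => by simp [h1]⟩
    · exact ⟨fun _ => 1, differentiable_const _, fun _ => one_ne_zero, fun z => by simp [h2]⟩
  | zero => exact ⟨fun _ => 1, differentiable_const _, fun _ => one_ne_zero, fun z => by simp⟩
  | add x y _ _ hx hy =>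
    obtain ⟨e, he, he0, hx⟩ := hx
    obtain ⟨e', he', he0', hy⟩ := hy
    refine ⟨fun z => e' (z + x) * e z, by fun_prop, fun z => mul_ne_zero (he0' _) (he0 _), ?_⟩
    intro z
    rw [← add_assoc, hy, hx, mul_assoc]
  | neg x _ hx =>
    obtain ⟨e, he, he0, hx⟩ := hx
    refine ⟨fun z => (e (z + -x))⁻¹, ?_, fun z => inv_ne_zero (he0 _), fun z => ?_⟩
    · exact Differentiable.inv (by fun_prop) fun z => he0 _
    · rw [eq_inv_mul_iff_mul_eq₀ (he0 _), ← hx, neg_add_cancel_right]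

lemma proj_eq_proj_iff {z w : V} : proj τ z = proj τ w ↔ w - z ∈ lattice τ := by
  rw [proj, proj, QuotientAddGroup.eq, neg_add_eq_sub]

lemma proj_mem_baseLocus_iff {z : V} : proj τ z ∈ baseLocus τ ↔ ∀ s ∈ sections τ, s z = 0 := by
  refine ⟨fun h s hs => h s hs z rfl, fun h s hs w hw => ?_⟩
  obtain ⟨e, -, he, hse⟩ := exists_factor_of_mem_lattice hs (proj_eq_proj_iff.1 hw)
  have := hse w
  rw [add_sub_cancel, h s hs] at this
  exact (mul_eq_zero.1 this.symm).resolve_left (he w)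

lemma mem_lattice_iff {l : V} : l ∈ lattice τ ↔
    ∃ m n : Fin 3 → ℤ, (∀ j, l j = m j + n j * τ j) ∧ ∀ j, 2 ∣ m j - m 0 := by
  constructor
  · intro hl
    induction hl using AddSubgroup.closure_induction with
    | mem x hx =>
      rcases hx with (⟨j, rfl⟩ | ⟨j, rfl⟩) | rfl
      · refine ⟨0, Pi.single j 1, fun i => ?_, by simp⟩
        rcases eq_or_ne i j with rfl | h <;> simp [*]
      · refine ⟨Pi.single j 2, 0, fun i => ?_, fun i => ?_⟩
        · rcases eq_or_ne i j with rfl | h <;> simp [*]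
        · refine dvd_sub ?_ ?_ <;> simp only [Pi.single_apply] <;> split_ifs <;> simp
      · exact ⟨1, 0, fun i => by simp, by simp⟩
    | zero => exact ⟨0, 0, by simp, by simp⟩
    | add x y _ _ hx hy =>
      obtain ⟨m, n, h, hm⟩ := hx
      obtain ⟨m', n', h', hm'⟩ := hy
      refine ⟨m + m', n + n', fun j => ?_, fun j => ?_⟩
      · simp only [Pi.add_apply, h, h']; push_cast; ring
      · have := hm j
        have := hm' j
        simp only [Pi.add_apply]
        omega
    | neg x _ hx =>
      obtain ⟨m, n, h, hm⟩ := hx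
      refine ⟨-m, -n, fun j => ?_, fun j => ?_⟩
      · simp only [Pi.neg_apply, h]; push_cast; ring
      · have := hm j
        simp only [Pi.neg_apply]
        omega
  · rintro ⟨m, n, h, hm⟩
    choose c hc using hm
    have h1 : ∀ j, (Pi.single j (τ j : ℂ) : V) ∈ lattice τ := fun j =>
      AddSubgroup.subset_closure (Or.inl (Or.inl ⟨j, rfl⟩))
    have h2 : ∀ j, (Pi.single j 2 : V) ∈ lattice τ := fun j =>
      AddSubgroup.subset_closure (Or.inl (Or.inr ⟨j, rfl⟩))
    have h3 : (fun _ => 1 : V) ∈ lattice τ := AddSubgroup.subset_closure (Or.inr rfl)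
    have hl : l = (∑ j, n j • (Pi.single j (τ j : ℂ) : V)) +
        (∑ j, c j • (Pi.single j 2 : V)) + m 0 • (fun _ => 1 : V) := by
      funext i
      have e : (m i : ℂ) = m 0 + 2 * c i := by
        have := hc i
        have : m i = m 0 + 2 * c i := by omega
        exact_mod_cast congrArg (Int.cast : ℤ → ℂ) this
      rw [h, e]
      simp only [Pi.add_apply, Finset.sum_apply, zsmul_eq_mul]
      fin_cases i <;> simp [Fin.sum_univ_three] <;> ring
    rw [hl]
    exact add_mem (add_mem (sum_mem fun j _ => zsmul_mem (h1 j) _)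
      (sum_mem fun j _ => zsmul_mem (h2 j) _)) (zsmul_mem h3 _)

/-! ### The base points -/

/-- The coordinates of `z` are zeros of `θ_{k 0}`, `θ_{k 1}`, `θ_{k 2}`, where
`k 0 + k 1 + k 2 = 0`. -/
def HasType (τ : Fin 3 → UpperHalfPlane) (k : Fin 3 → Fin 2) (z : V) : Prop :=
  k 0 = k 1 + k 2 ∧ ∀ j, theta (k j) (z j) (τ j) = 0

/-- Translating by `e_i` changes the factor for `τ_ii e_i` only by `exp (-2πi) = 1`. -/
lemma shift_mem_sections {s : V → ℂ} (hs : s ∈ sections τ) (i : Fin 3) :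
    (fun z => s (z + Pi.single i 1)) ∈ sections τ := by
  obtain ⟨h0, h1, h2, h3⟩ := hs
  refine ⟨h0.comp (differentiable_id.add_const _), fun z j => ?_, fun z => ?_, fun z j => ?_⟩
  · simp only [add_right_comm z _ (Pi.single i 1), h1]
  · simp only [add_right_comm z _ (Pi.single i 1), h2]
  · simp only [add_right_comm z _ (Pi.single i 1), h3]
    congr 1
    rcases eq_or_ne j i with rfl | h
    · rw [Complex.exp_eq_exp_iff_exists_int]
      exact ⟨-1, by simp; ring⟩
    · simp [h]

lemma shift_shift {s : V → ℂ} (hs : s ∈ sections τ) (i : Fin 3) (z : V) :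
    s (z + Pi.single i 1 + Pi.single i 1) = s z := by
  rw [add_assoc, ← Pi.single_add, one_add_one_eq_two, hs.2.1]

lemma shift_zero {s : V → ℂ} (hs : s ∈ sections τ) (z : V) :
    s (z + Pi.single 0 1) = s (z + Pi.single 1 1 + Pi.single 2 1) := by
  rw [← hs.2.2.1 (z + Pi.single 0 1), ← shift_shift hs 0 (z + Pi.single 1 1 + Pi.single 2 1),
    ← hs.2.1 (z + Pi.single 1 1 + Pi.single 2 1 + Pi.single 0 1 + Pi.single 0 1) 0,
    ← hs.2.1 (z + Pi.single 0 1 + fun _ => 1) 0]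
  congr 1
  funext i
  fin_cases i <;> simp

/-- Restricted to a line in direction `e_j`, an eigensection satisfies the functional equations of
`θ_a`. -/
lemma eq_zero_of_shift {s : V → ℂ} (hs : s ∈ sections τ) (j : Fin 3) (a : Fin 2)
    (h : ∀ z, s (z + Pi.single j 1) = (-1) ^ (a : ℕ) * s z) {z : V}
    (hz : theta a (z j) (τ j) = 0) : s z = 0 := by
  obtain ⟨h0, h1, h2, h3⟩ := hs
  have hd : Differentiable ℂ fun u : ℂ => s (z + Pi.single j (u - z j)) := by
    refine h0.comp ((differentiable_const z).add ?_)
    rw [differentiable_pi]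
    intro i
    rcases eq_or_ne i j with rfl | h
    · simp
    · simp [h]
  have := eq_zero_of_theta_eq_zero (τ j).im_pos (h := a) hd (fun u => ?_) (fun u => ?_) hz
  · simpa using this
  · rw [← h, add_assoc, ← Pi.single_add, add_sub_right_comm]
  · have := h3 (z + Pi.single j (u - z j)) j
    rw [add_assoc, ← Pi.single_add, sub_add_eq_add_sub] at this
    rw [this, autFactor]
    simp

lemma eq_zero_of_hasType {s : V → ℂ} (hs : s ∈ sections τ) {k : Fin 3 → Fin 2} {z : V}
    (hk : HasType τ k z) : s z = 0 := by
  obtain ⟨hk0, hk⟩ := hk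
  -- Four times the projection of `s` to the eigenspace with signs `(-1)^a`, `(-1)^b` under `e_1`,
  -- `e_2` (indices from 0); the four projections sum to `s`.
  let S : Fin 2 → Fin 2 → V → ℂ := fun a b =>
    s + (-1 : ℂ) ^ (a : ℕ) • (fun z => s (z + Pi.single 1 1)) +
      (-1 : ℂ) ^ (b : ℕ) • (fun z => s (z + Pi.single 2 1)) +
      ((-1 : ℂ) ^ (a : ℕ) * (-1 : ℂ) ^ (b : ℕ)) •
        (fun z => s (z + Pi.single 1 1 + Pi.single 2 1))
  have hS : ∀ a b, S a b ∈ sections τ := fun a b =>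
    add_mem (add_mem (add_mem hs (Submodule.smul_mem _ _ (shift_mem_sections hs 1)))
      (Submodule.smul_mem _ _ (shift_mem_sections hs 2)))
      (Submodule.smul_mem _ _ (shift_mem_sections (shift_mem_sections hs 2) 1))
  have hsq : ∀ a : Fin 2, ((-1 : ℂ) ^ (a : ℕ)) * ((-1 : ℂ) ^ (a : ℕ)) = 1 := fun a => by
    rw [← mul_pow]; simp
  have hS1 : ∀ a b z, S a b (z + Pi.single 1 1) = (-1) ^ (a : ℕ) * S a b z := fun a b z => by
    have e : s (z + Pi.single 1 1 + Pi.single 1 1 + Pi.single 2 1) = s (z + Pi.single 2 1) := by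
      rw [add_right_comm, add_right_comm z, shift_shift hs]
    simp only [S, Pi.add_apply, Pi.smul_apply, smul_eq_mul, e, shift_shift hs]
    linear_combination (-s (z + Pi.single 1 1) - (-1) ^ (b : ℕ) * s (z + Pi.single 1 1 + Pi.single 2 1)) *
      hsq a
  have hS2 : ∀ a b z, S a b (z + Pi.single 2 1) = (-1) ^ (b : ℕ) * S a b z := fun a b z => by
    simp only [S, Pi.add_apply, Pi.smul_apply, smul_eq_mul, shift_shift hs,
      add_right_comm z (Pi.single 2 1) (Pi.single 1 1)]
    linear_combination (-s (z + Pi.single 2 1) - (-1) ^ (a : ℕ) * s (z + Pi.single 1 1 + Pi.single 2 1)) *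
      hsq b
  have hS0 : ∀ a b z, S a b (z + Pi.single 0 1) = (-1) ^ ((a + b : Fin 2) : ℕ) * S a b z := by
    intro a b z
    rw [shift_zero (hS a b), hS2, hS1]
    fin_cases a <;> fin_cases b <;> simp
  have hzero : ∀ a b, S a b z = 0 := by
    intro a b
    -- Two even-weight vectors in `𝔽₂³` agree somewhere, since their difference has even weight and
    -- is not `(1, 1, 1)`.
    have hc : k 0 = a + b ∨ k 1 = a ∨ k 2 = b := by
      rw [hk0]
      generalize k 1 = x; generalize k 2 = y
      revert a b x y; decide
    rcases hc with h | h | h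
    · exact eq_zero_of_shift (hS a b) 0 _ (hS0 a b) (h ▸ hk 0)
    · exact eq_zero_of_shift (hS a b) 1 _ (hS1 a b) (h ▸ hk 1)
    · exact eq_zero_of_shift (hS a b) 2 _ (hS2 a b) (h ▸ hk 2)
  have h00 := hzero 0 0
  have h01 := hzero 0 1
  have h10 := hzero 1 0
  have h11 := hzero 1 1
  simp [S] at h00 h01 h10 h11
  linear_combination (h00 + h01 + h10 + h11) / 4

lemma exists_hasType {z : V} (h : ∀ s ∈ sections τ, s z = 0) : ∃ k, HasType τ k z := by
  have h000 := h _ (theta3_mem_sections (i := 0) (j := 0) (k := 0) rfl)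
  have h011 := h _ (theta3_mem_sections (i := 0) (j := 1) (k := 1) rfl)
  have h101 := h _ (theta3_mem_sections (i := 1) (j := 0) (k := 1) rfl)
  have h110 := h _ (theta3_mem_sections (i := 1) (j := 1) (k := 0) rfl)
  have hne : ∀ j, theta 0 (z j) (τ j) = 0 → theta 1 (z j) (τ j) ≠ 0 := fun j h0 h1 =>
    absurd (eq_of_theta_eq_zero (τ j).im_pos h0 h1) (by decide)
  have n0 := hne 0
  have n1 := hne 1
  have n2 := hne 2
  simp only [theta3, mul_eq_zero] at h000 h011 h101 h110
  -- If no theta function vanished at some coordinate, an even index avoiding the zeros at the other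
  -- two could be completed by parity. So each coordinate has a vanishing index; the complementary
  -- index vector is not even, hence the vanishing one is.
  have : (theta 0 (z 0) (τ 0) = 0 ∧ theta 0 (z 1) (τ 1) = 0 ∧ theta 0 (z 2) (τ 2) = 0) ∨
      (theta 0 (z 0) (τ 0) = 0 ∧ theta 1 (z 1) (τ 1) = 0 ∧ theta 1 (z 2) (τ 2) = 0) ∨
      (theta 1 (z 0) (τ 0) = 0 ∧ theta 0 (z 1) (τ 1) = 0 ∧ theta 1 (z 2) (τ 2) = 0) ∨
      (theta 1 (z 0) (τ 0) = 0 ∧ theta 1 (z 1) (τ 1) = 0 ∧ theta 0 (z 2) (τ 2) = 0) := by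
    clear hne h
    grind
  rcases this with h | h | h | h
  · exact ⟨![0, 0, 0], rfl, Fin.forall_fin_succ.2 ⟨h.1, Fin.forall_fin_two.2 h.2⟩⟩
  · exact ⟨![0, 1, 1], rfl, Fin.forall_fin_succ.2 ⟨h.1, Fin.forall_fin_two.2 h.2⟩⟩
  · exact ⟨![1, 0, 1], rfl, Fin.forall_fin_succ.2 ⟨h.1, Fin.forall_fin_two.2 h.2⟩⟩
  · exact ⟨![1, 1, 0], rfl, Fin.forall_fin_succ.2 ⟨h.1, Fin.forall_fin_two.2 h.2⟩⟩

/-- The type of a base point is determined by two bits. -/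
def baseType (q : (Fin 2 × Fin 2) × Fin 2 × Fin 2) : Fin 3 → Fin 2 :=
  ![q.1.1 + q.1.2, q.1.1, q.1.2]

/-- The position of a base point among those of its type. -/
def baseShift (q : (Fin 2 × Fin 2) × Fin 2 × Fin 2) : Fin 3 → Fin 2 := ![0, q.2.1, q.2.2]

/-- Representatives of the base points. -/
noncomputable def baseRep (τ : Fin 3 → UpperHalfPlane) (q : (Fin 2 × Fin 2) × Fin 2 × Fin 2) : V :=
  fun j => root (baseType q j) (τ j) + ((baseShift q j : ℕ) : ℂ)

lemma hasType_baseRep (q : (Fin 2 × Fin 2) × Fin 2 × Fin 2) :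
    HasType τ (baseType q) (baseRep τ q) := by
  refine ⟨rfl, fun j => (theta_eq_zero_iff (τ j).im_pos _ _).2 ⟨(baseShift q j : ℕ), 0, ?_⟩⟩
  simp [baseRep]

/-- Imaginary parts give equality of types and then `n = 0`. The shifts differ by integers congruent
modulo 2, and the one at coordinate 0 is zero. -/
lemma proj_baseRep_injective : Function.Injective fun q => proj τ (baseRep τ q) := by
  intro q r h
  obtain ⟨m, n, hl, hm⟩ := mem_lattice_iff.1 (proj_eq_proj_iff.1 h.symm)
  have hroot : ∀ j, baseType q j = baseType r j := fun j => by
    refine root_eq_of_sub_eq (τ j).im_pos (m := m j - (baseShift q j : ℕ) + (baseShift r j : ℕ))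
      (n := n j) ?_
    have := hl j
    simp only [Pi.sub_apply, baseRep] at this
    push_cast
    linear_combination this
  have hshift : ∀ j, ((baseShift q j : ℕ) : ℤ) - (baseShift r j : ℕ) = m j := fun j => by
    have h1 := hl j
    simp only [Pi.sub_apply, baseRep, hroot] at h1
    have him := congrArg Complex.im h1
    simp at him
    have hn : n j = 0 := him.resolve_right (τ j).im_ne_zero
    rw [hn] at h1
    have : (((baseShift q j : ℕ) : ℤ) - (baseShift r j : ℕ) : ℂ) = (m j : ℂ) := by
      push_cast at h1 ⊢
      linear_combination h1
    exact_mod_cast this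
  have e0 := hshift 0
  have e1 := hshift 1
  have e2 := hshift 2
  have t1 := hroot 1
  have t2 := hroot 2
  have d1 := hm 1
  have d2 := hm 2
  obtain ⟨⟨q1, q2⟩, q3, q4⟩ := q
  obtain ⟨⟨r1, r2⟩, r3, r4⟩ := r
  simp [baseShift, baseType] at e0 e1 e2 t1 t2
  have := q3.2; have := q4.2; have := r3.2; have := r4.2
  simp only [Prod.mk.injEq, t1, t2, true_and, Fin.ext_iff]
  omega

lemma range_proj_baseRep : Set.range (fun q => proj τ (baseRep τ q)) = baseLocus τ := by
  ext P
  constructor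
  · rintro ⟨q, rfl⟩
    exact proj_mem_baseLocus_iff.2 fun s hs => eq_zero_of_hasType hs (hasType_baseRep q)
  · obtain ⟨z, rfl⟩ := QuotientAddGroup.mk_surjective P
    intro h
    obtain ⟨k, hk0, hk⟩ := exists_hasType (proj_mem_baseLocus_iff.1 h)
    choose m n hz using fun j => (theta_eq_zero_iff (τ j).im_pos _ _).1 (hk j)
    -- Modulo `e₁ + e₂ + e₃` and the `2 e_j`, only the parities of `m j - m 0` matter.
    have hε : ∀ j, ∃ ε : Fin 2, 2 ∣ m j - m 0 - ε := fun j => by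
      rcases Int.emod_two_eq_zero_or_one (m j - m 0) with h | h
      · exact ⟨0, by simp; omega⟩
      · exact ⟨1, by simp; omega⟩
    choose ε hε using hε
    refine ⟨((k 1, k 2), ε 1, ε 2), proj_eq_proj_iff.2 (mem_lattice_iff.2
      ⟨fun j => m j - (baseShift ((k 1, k 2), ε 1, ε 2) j : ℕ), n, fun j => ?_, fun j => ?_⟩)⟩
    · have : baseType ((k 1, k 2), ε 1, ε 2) j = k j := by
        fin_cases j <;> simp [baseType, hk0]
      simp only [Pi.sub_apply, baseRep, this, hz j]
      push_cast
      ring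
    · have h1 := hε 1
      have h2 := hε 2
      fin_cases j
      · simp
      · simp [baseShift]; omega
      · simp [baseShift]; omega

lemma ncard_baseLocus : (baseLocus τ).ncard = 16 := by
  rw [← range_proj_baseRep, ← Set.image_univ, Set.ncard_image_of_injective _ proj_baseRep_injective,
    Set.ncard_univ]
  simp

/-! ### Properties of general parameters -/

/-- `p` holds for general `(b, c, d)`. -/
def Generic (p : ℂ → ℂ → ℂ → Prop) : Prop :=
  ∃ F : MvPolynomial (Fin 3) ℂ, F ≠ 0 ∧ ∀ b c d : ℂ, MvPolynomial.eval ![b, c, d] F ≠ 0 → p b c d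

lemma Generic.mono {p q : ℂ → ℂ → ℂ → Prop} (hp : Generic p) (h : ∀ b c d, p b c d → q b c d) :
    Generic q := by
  obtain ⟨F, hF, hp⟩ := hp
  exact ⟨F, hF, fun b c d hb => h b c d (hp b c d hb)⟩

lemma Generic.and {p q : ℂ → ℂ → ℂ → Prop} (hp : Generic p) (hq : Generic q) :
    Generic fun b c d => p b c d ∧ q b c d := by
  obtain ⟨F, hF, hp⟩ := hp
  obtain ⟨G, hG, hq⟩ := hq
  refine ⟨F * G, mul_ne_zero hF hG, fun b c d h => ?_⟩
  rw [map_mul, mul_ne_zero_iff] at h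
  exact ⟨hp b c d h.1, hq b c d h.2⟩

lemma Generic.forall_mem {ι : Type*} {s : Set ι} (hs : s.Finite) {p : ι → ℂ → ℂ → ℂ → Prop}
    (hp : ∀ i, Generic (p i)) : Generic fun b c d => ∀ i ∈ s, p i b c d := by
  choose F hF hp using hp
  refine ⟨∏ i ∈ hs.toFinset, F i, Finset.prod_ne_zero_iff.2 fun i _ => hF i,
    fun b c d h i hi => hp i b c d ?_⟩
  rw [map_prod, Finset.prod_ne_zero_iff] at h
  exact h i (hs.mem_toFinset.2 hi)

lemma Generic.of_eval_ne_zero (F : MvPolynomial (Fin 3) ℂ) (v : Fin 3 → ℂ)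
    (hv : MvPolynomial.eval v F ≠ 0) : Generic fun b c d => MvPolynomial.eval ![b, c, d] F ≠ 0 :=
  ⟨F, fun h => hv (by rw [h, map_zero]), fun _ _ _ h => h⟩

/-! ### The differential of the equation of the surface -/

variable {b c d : ℂ}

/-- The gradient of the equation of the surface. -/
noncomputable def surfaceGrad (τ : Fin 3 → UpperHalfPlane) (b c d : ℂ) (z : V) : Fin 3 → ℂ :=
  let x := fun j => theta 0 (z j) (τ j)
  let y := fun j => theta 1 (z j) (τ j)
  let x' := fun j => deriv (theta 0 · (τ j)) (z j)
  let y' := fun j => deriv (theta 1 · (τ j)) (z j)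
  ![x' 0 * (x 1 * x 2 + b * (y 1 * y 2)) + y' 0 * (c * (x 1 * y 2) + d * (y 1 * x 2)),
    x' 1 * (x 0 * x 2 + c * (y 0 * y 2)) + y' 1 * (b * (x 0 * y 2) + d * (y 0 * x 2)),
    x' 2 * (x 0 * x 1 + d * (y 0 * y 1)) + y' 2 * (b * (x 0 * y 1) + c * (y 0 * x 1))]

lemma fderiv_surfaceEq_apply (τ : Fin 3 → UpperHalfPlane) (b c d : ℂ) (z v : V) :
    fderiv ℂ (surfaceEq τ b c d) z v = ∑ j, surfaceGrad τ b c d z j * v j := by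
  have hd : ∀ (h : Fin 2) (j : Fin 3), HasFDerivAt (fun z : V => theta h (z j) (τ j))
      (deriv (theta h · (τ j)) (z j) • ContinuousLinearMap.proj (R := ℂ) (φ := fun _ => ℂ) j) z :=
    fun h j => HasDerivAt.comp_hasFDerivAt (f := fun z : V => z j) z
      (differentiable_theta (τ j).im_pos h (z j)).hasDerivAt (hasFDerivAt_apply j z)
  have h3 := fun i j k => ((hd i 0).mul (hd j 1)).mul (hd k 2)
  have := (((h3 0 0 0).add ((h3 0 1 1).const_mul b)).add ((h3 1 0 1).const_mul c)).add
    ((h3 1 1 0).const_mul d)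
  have hf : HasFDerivAt (surfaceEq τ b c d) _ z := this
  rw [hf.fderiv, Fin.sum_univ_three]
  simp [surfaceGrad]
  ring

lemma surfaceGrad_ne_zero_of_fderiv {z : V} (h : fderiv ℂ (surfaceEq τ b c d) z ≠ 0) :
    surfaceGrad τ b c d z ≠ 0 := fun h0 => h <| by
  ext v
  simp [fderiv_surfaceEq_apply, h0]

lemma surfaceGrad_eq_zero {z : V} (h : fderiv ℂ (surfaceEq τ b c d) z = 0) (j : Fin 3) :
    surfaceGrad τ b c d z j = 0 := by
  have := fderiv_surfaceEq_apply τ b c d z (Pi.single j 1)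
  simpa [h, Pi.single_apply] using this.symm

/-! ### Smoothness of the general surface -/

lemma det_eq_zero_of_kernel {p q r s X Y : ℂ} (h1 : p * X + q * Y = 0) (h2 : r * X + s * Y = 0)
    (h : X ≠ 0 ∨ Y ≠ 0) : p * s - q * r = 0 := by
  rcases h with h | h
  · exact (mul_eq_zero.1 (by linear_combination s * h1 - q * h2 :
      (p * s - q * r) * X = 0)).resolve_right h
  · exact (mul_eq_zero.1 (by linear_combination p * h2 - r * h1 :
      (p * s - q * r) * Y = 0)).resolve_right h

lemma eq_zero_of_wronskian_ne_zero {x y x' y' A B : ℂ} (h : x * A + y * B = 0)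
    (h' : x' * A + y' * B = 0) (hW : x * y' - y * x' ≠ 0) : A = 0 ∧ B = 0 :=
  ⟨(mul_eq_zero.1 (by linear_combination y' * h - y * h' :
      (x * y' - y * x') * A = 0)).resolve_left hW,
    (mul_eq_zero.1 (by linear_combination x * h' - x' * h :
      (x * y' - y * x') * B = 0)).resolve_left hW⟩

lemma not_forall_partial_eq_zero {x y : Fin 3 → ℂ} (hxy : ∀ j, x j ≠ 0 ∨ y j ≠ 0)
    (hb : b ≠ 0) (hc : c ≠ 0) (hd : d ≠ 0)
    (_hA0 : x 1 * x 2 + b * (y 1 * y 2) = 0) (hB0 : c * (x 1 * y 2) + d * (y 1 * x 2) = 0)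
    (hA1 : x 0 * x 2 + c * (y 0 * y 2) = 0) (hB1 : b * (x 0 * y 2) + d * (y 0 * x 2) = 0)
    (hA2 : x 0 * x 1 + d * (y 0 * y 1) = 0) (hB2 : b * (x 0 * y 1) + c * (y 0 * x 1) = 0) :
    False := by
  have h0 := hxy 0
  have h1 := hxy 1
  have h2 := hxy 2
  clear hxy
  -- Multiplying `hB0`, `hB1`, `hB2` by `y 0`, `y 1`, `y 2` shows that `b x₀y₁y₂`, `c y₀x₁y₂`, `d
  -- y₀y₁x₂` have pairwise sums zero, so twice the first is zero. The common multiplier here is `c d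
  -- y₀x₁x₂`.
  have key : 2 * (b * c * d) * (x 0 * x 1 * x 2 * (y 0 * y 1 * y 2)) = 0 := by
    linear_combination (c * d * x 1 * y 2 * y 0 * x 2) * hB2 -
      (c * d * y 0 * x 1 * y 0 * x 2) * hB0 + (c * d * y 0 * x 1 * y 1 * x 2) * hB1
  have : x 0 = 0 ∨ x 1 = 0 ∨ x 2 = 0 ∨ y 0 = 0 ∨ y 1 = 0 ∨ y 2 = 0 := by
    simp only [mul_eq_zero, hb, hc, hd, OfNat.ofNat_ne_zero, false_or] at key
    tauto
  rcases this with h | h | h | h | h | h <;> simp_all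

/-- The conditions on the parameters which make the surface smooth. -/
def SmoothCondition (τ : Fin 3 → UpperHalfPlane) (b c d : ℂ) : Prop :=
  (b ≠ 0 ∧ c ≠ 0 ∧ d ≠ 0) ∧
  (∀ l ∈ branchValues (τ 0), b - c * d * l ^ 2 ≠ 0) ∧
  (∀ l ∈ branchValues (τ 1), c - b * d * l ^ 2 ≠ 0) ∧
  (∀ l ∈ branchValues (τ 2), d - b * c * l ^ 2 ≠ 0) ∧
  ∀ l ∈ branchValues (τ 0), ∀ m ∈ branchValues (τ 1), ∀ n ∈ branchValues (τ 2),
    1 + b * (m * n) + c * (l * n) + d * (l * m) ≠ 0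

open MvPolynomial in
lemma generic_smoothCondition (τ : Fin 3 → UpperHalfPlane) : Generic (SmoothCondition τ) := by
  have hfin := fun j => finite_branchValues (τ j).im_pos
  refine .and ?_ (.and (.forall_mem (hfin 0) fun l => ?_) (.and (.forall_mem (hfin 1) fun l => ?_)
    (.and (.forall_mem (hfin 2) fun l => ?_) (.forall_mem (hfin 0) fun l =>
      .forall_mem (hfin 1) fun m => .forall_mem (hfin 2) fun n => ?_))))
  · refine (Generic.of_eval_ne_zero (X 0 * X 1 * X 2) 1 (by simp)).mono fun b c d h => ?_
    simpa [and_assoc] using h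
  -- The test point kills the term containing `l`, so it serves for every branch value.
  · refine (Generic.of_eval_ne_zero (X 0 - X 1 * X 2 * C (l ^ 2)) ![1, 0, 0] (by simp)).mono
      fun b c d h => ?_
    simpa using h
  · refine (Generic.of_eval_ne_zero (X 1 - X 0 * X 2 * C (l ^ 2)) ![0, 1, 0] (by simp)).mono
      fun b c d h => ?_
    simpa using h
  · refine (Generic.of_eval_ne_zero (X 2 - X 0 * X 1 * C (l ^ 2)) ![0, 0, 1] (by simp)).mono
      fun b c d h => ?_
    simpa using h
  · refine (Generic.of_eval_ne_zero
      (1 + X 0 * C (m * n) + X 1 * C (l * n) + X 2 * C (l * m)) 0 (by simp)).mono fun b c d h => ?_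
    simpa using h

/-- Cases by which Wronskians vanish. If all do, the surface equation is a relation between branch
values. If that of `i` does and that of `j` does not, `A_j = B_j = 0` is a linear system in `(x_k,
y_k)` for the third index `k`, and its determinant is the quadratic relation excluded at `i`. If
none does, `not_forall_partial_eq_zero` applies. -/
lemma SmoothCondition.isSmoothDivisor (h : SmoothCondition τ b c d) :
    IsSmoothDivisor (surfaceEq τ b c d) := by
  obtain ⟨⟨hb, hc, hd⟩, h0, h1, h2, h3⟩ := h
  intro z hz hf
  have g0 := surfaceGrad_eq_zero hf 0
  have g1 := surfaceGrad_eq_zero hf 1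
  have g2 := surfaceGrad_eq_zero hf 2
  have hxy : ∀ j, theta 0 (z j) (τ j) ≠ 0 ∨ theta 1 (z j) (τ j) ≠ 0 := fun j => by
    by_contra! h
    exact absurd (eq_of_theta_eq_zero (τ j).im_pos h.1 h.2) (by decide)
  have hx : ∀ j, wronskian (τ j) (z j) = 0 → theta 0 (z j) (τ j) ≠ 0 ∧
      theta 1 (z j) (τ j) / theta 0 (z j) (τ j) ∈ branchValues (τ j) := fun j h =>
    ⟨theta_ne_zero_of_wronskian (τ j).im_pos h 0, _, h, rfl⟩
  simp only [surfaceEq, theta3] at hz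
  simp only [surfaceGrad, Matrix.cons_val_zero, Matrix.cons_val_one, Matrix.cons_val] at g0 g1 g2
  simp only [wronskian] at hx
  have hx0 := hx 0
  have hx1 := hx 1
  have hx2 := hx 2
  have hxy0 := hxy 0
  have hxy1 := hxy 1
  have hxy2 := hxy 2
  set x : Fin 3 → ℂ := fun j => theta 0 (z j) (τ j) with hxdef
  set y : Fin 3 → ℂ := fun j => theta 1 (z j) (τ j) with hydef
  change x 0 * x 1 * x 2 + b * (x 0 * y 1 * y 2) + c * (y 0 * x 1 * y 2) +
    d * (y 0 * y 1 * x 2) = 0 at hz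
  have k0 := eq_zero_of_wronskian_ne_zero (x := x 0) (y := y 0) (by linear_combination hz) g0
  have k1 := eq_zero_of_wronskian_ne_zero (x := x 1) (y := y 1) (by linear_combination hz) g1
  have k2 := eq_zero_of_wronskian_ne_zero (x := x 2) (y := y 2) (by linear_combination hz) g2
  have e0 : b * x 0 ^ 2 - c * d * y 0 ^ 2 = 0 → x 0 ≠ 0 →
      y 0 / x 0 ∈ branchValues (τ 0) → False := fun e hx hm =>
    h0 _ hm (by field_simp; linear_combination e)
  have e1 : c * x 1 ^ 2 - b * d * y 1 ^ 2 = 0 → x 1 ≠ 0 →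
      y 1 / x 1 ∈ branchValues (τ 1) → False := fun e hx hm =>
    h1 _ hm (by field_simp; linear_combination e)
  have e2 : d * x 2 ^ 2 - b * c * y 2 ^ 2 = 0 → x 2 ≠ 0 →
      y 2 / x 2 ∈ branchValues (τ 2) → False := fun e hx hm =>
    h2 _ hm (by field_simp; linear_combination e)
  by_cases w0 : x 0 * deriv (theta 1 · (τ 0)) (z 0) - y 0 * deriv (theta 0 · (τ 0)) (z 0) = 0 <;>
  by_cases w1 : x 1 * deriv (theta 1 · (τ 1)) (z 1) - y 1 * deriv (theta 0 · (τ 1)) (z 1) = 0 <;>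
  by_cases w2 : x 2 * deriv (theta 1 · (τ 2)) (z 2) - y 2 * deriv (theta 0 · (τ 2)) (z 2) = 0
  · obtain ⟨n0, m0⟩ := hx0 w0
    obtain ⟨n1, m1⟩ := hx1 w1
    obtain ⟨n2, m2⟩ := hx2 w2
    have n0 : x 0 ≠ 0 := n0
    have n1 : x 1 ≠ 0 := n1
    have n2 : x 2 ≠ 0 := n2
    refine h3 _ m0 _ m1 _ m2 ?_
    change 1 + b * (y 1 / x 1 * (y 2 / x 2)) + c * (y 0 / x 0 * (y 2 / x 2)) +
      d * (y 0 / x 0 * (y 1 / x 1)) = 0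
    field_simp
    linear_combination hz
  · refine e0 ?_ (hx0 w0).1 (hx0 w0).2
    obtain ⟨A, B⟩ := k2 w2
    linear_combination det_eq_zero_of_kernel (p := x 0) (q := d * y 0) (r := c * y 0)
      (s := b * x 0) (by linear_combination A) (by linear_combination B) hxy1
  · refine e0 ?_ (hx0 w0).1 (hx0 w0).2
    obtain ⟨A, B⟩ := k1 w1
    linear_combination det_eq_zero_of_kernel (p := x 0) (q := c * y 0) (r := d * y 0)
      (s := b * x 0) (by linear_combination A) (by linear_combination B) hxy2
  · refine e0 ?_ (hx0 w0).1 (hx0 w0).2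
    obtain ⟨A, B⟩ := k1 w1
    linear_combination det_eq_zero_of_kernel (p := x 0) (q := c * y 0) (r := d * y 0)
      (s := b * x 0) (by linear_combination A) (by linear_combination B) hxy2
  · refine e1 ?_ (hx1 w1).1 (hx1 w1).2
    obtain ⟨A, B⟩ := k0 w0
    linear_combination det_eq_zero_of_kernel (p := x 1) (q := b * y 1) (r := d * y 1)
      (s := c * x 1) (by linear_combination A) (by linear_combination B) hxy2
  · refine e1 ?_ (hx1 w1).1 (hx1 w1).2
    obtain ⟨A, B⟩ := k0 w0
    linear_combination det_eq_zero_of_kernel (p := x 1) (q := b * y 1) (r := d * y 1)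
      (s := c * x 1) (by linear_combination A) (by linear_combination B) hxy2
  · refine e2 ?_ (hx2 w2).1 (hx2 w2).2
    obtain ⟨A, B⟩ := k0 w0
    linear_combination det_eq_zero_of_kernel (p := x 2) (q := b * y 2) (r := c * y 2)
      (s := d * x 2) (by linear_combination A) (by linear_combination B) hxy1
  · obtain ⟨A0, B0⟩ := k0 w0
    obtain ⟨A1, B1⟩ := k1 w1
    obtain ⟨A2, B2⟩ := k2 w2
    exact not_forall_partial_eq_zero hxy hb hc hd A0 B0 A1 B1 A2 B2

lemma surfaceEq_mem_sections : surfaceEq τ b c d ∈ sections τ := by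
  have h := fun (b : ℂ) i j k h =>
    (sections τ).smul_mem b (theta3_mem_sections (i := i) (j := j) (k := k) h)
  have := add_mem (add_mem (add_mem (theta3_mem_sections (τ := τ) (i := 0) (j := 0) (k := 0) rfl)
    (h b 0 1 1 rfl)) (h c 1 0 1 rfl)) (h d 1 1 0 rfl)
  exact this

lemma baseLocus_subset_surface : baseLocus τ ⊆ surface τ b c d := by
  intro P hP
  obtain ⟨z, rfl⟩ := QuotientAddGroup.mk_surjective P
  exact ⟨z, hP _ surfaceEq_mem_sections z rfl, rfl⟩

/-! ### Translation-invariant 2-forms and the canonical map -/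

/-- The invariant 2-form `(u₀, u₁) ↦ det (v, u₀, u₁)` on `ℂ³`. -/
def invariantForm (v : V) : V [⋀^Fin 2]→L[ℂ] ℂ :=
  { (Matrix.detRowAlternating (n := Fin 3) (R := ℂ)).curryLeft v with
    cont := by
      change Continuous fun u : Fin 2 → V => Matrix.det (Matrix.of (Matrix.vecCons v u))
      refine Continuous.matrix_det ?_
      refine continuous_pi fun i => ?_
      refine Fin.cases continuous_const (fun j => ?_) i
      exact continuous_apply j }

lemma invariantForm_apply (v : V) (u : Fin 2 → V) :
    invariantForm v u = v 0 * (u 0 1 * u 1 2 - u 0 2 * u 1 1) -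
      v 1 * (u 0 0 * u 1 2 - u 0 2 * u 1 0) + v 2 * (u 0 0 * u 1 1 - u 0 1 * u 1 0) := by
  change Matrix.det (Matrix.of (Matrix.vecCons v u)) = _
  rw [Matrix.det_fin_three]
  change v 0 * u 0 1 * u 1 2 - v 0 * u 0 2 * u 1 1 - v 1 * u 0 0 * u 1 2 + v 1 * u 0 2 * u 1 0 +
    v 2 * u 0 0 * u 1 1 - v 2 * u 0 1 * u 1 0 = _
  ring

lemma mem_tangent_iff {f : V → ℂ} {z u : V} : u ∈ tangent f z ↔ fderiv ℂ f z u = 0 :=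
  LinearMap.mem_ker

/-- At a zero of `f` the product rule loses the derivative of the factor of automorphy, so the
differentials are proportional. -/
lemma tangent_eq_of_proj_eq {f : V → ℂ} (hf : f ∈ sections τ) {z w : V} (hz : f z = 0)
    (h : proj τ z = proj τ w) : tangent f z = tangent f w := by
  obtain ⟨e, he, he0, hfe⟩ := exists_factor_of_mem_lattice hf (proj_eq_proj_iff.1 h)
  have h1 : fderiv ℂ f w = e z • fderiv ℂ f z := by
    have h2 := fderiv_comp_add_right (𝕜 := ℂ) (f := f) (x := z) (w - z)
    rw [add_sub_cancel] at h2
    rw [← h2, funext hfe, fderiv_fun_mul (he z) (hf.1 z)]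
    ext u
    change e z * fderiv ℂ f z u + f z * fderiv ℂ e z u = e z * fderiv ℂ f z u
    rw [hz, zero_mul, add_zero]
  ext u
  simp [mem_tangent_iff, h1, he0]

/-- The restriction of an invariant 2-form to the surface. -/
noncomputable def invariantCanonicalForm (τ : Fin 3 → UpperHalfPlane) (f : V → ℂ) (v : V) :
    canonicalForms τ f :=
  ⟨fun z => (invariantForm v).toAlternatingMap.compLinearMap (tangent f z.1).subtype,
    fun _ => ⟨fun _ => invariantForm v, analyticAt_const,
      Filter.Eventually.of_forall fun _ _ _ => rfl⟩,
    fun z w _ u u' h => by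
      change invariantForm v (fun i => (u' i : V)) = invariantForm v (fun i => (u i : V))
      rw [funext h]⟩

lemma invariantCanonicalForm_apply (f : V → ℂ) (v : V) (z : {z : V // f z = 0})
    (u : Fin 2 → tangent f z.1) :
    (invariantCanonicalForm τ f v).1 z u = invariantForm v fun i => (u i : V) := rfl

lemma mem_canonicalMap_iff {f : V → ℂ} (hf : f ∈ sections τ) {z : V} (hz : f z = 0)
    (η : canonicalForms τ f) : η ∈ canonicalMap τ f (proj τ z) ↔ η.1 ⟨z, hz⟩ = 0 := by
  refine ⟨fun h => h ⟨z, hz⟩ rfl, fun h w hw => ?_⟩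
  ext u
  have ht := tangent_eq_of_proj_eq hf hz hw.symm
  have := η.2.2 ⟨z, hz⟩ w (proj_eq_proj_iff.1 hw.symm)
    (fun i => ⟨u i, ht.symm.le (u i).2⟩) u fun i => rfl
  rw [this, h]
  rfl

/-- Three vectors in the plane orthogonal to `g` are dependent; the identities below are Cramer's
rule. -/
lemma invariantForm_eq_zero {g v : V} (hg : g ≠ 0) {u : Fin 2 → V} (hv : ∑ j, g j * v j = 0)
    (hu : ∀ i, ∑ j, g j * u i j = 0) : invariantForm v u = 0 := by
  obtain ⟨i, hi⟩ := Function.ne_iff.1 hg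
  have h0 := hu 0
  have h1 := hu 1
  rw [Fin.sum_univ_three] at h0 h1 hv
  rw [invariantForm_apply]
  refine (mul_eq_zero.1 (?_ : g i * _ = 0)).resolve_left hi
  clear hi
  fin_cases i <;> simp only [Fin.zero_eta, Fin.mk_one, Fin.reduceFinMk]
  · linear_combination (u 0 1 * u 1 2 - u 0 2 * u 1 1) * hv - (v 1 * u 1 2 - v 2 * u 1 1) * h0 +
      (v 1 * u 0 2 - v 2 * u 0 1) * h1
  · linear_combination -(u 0 0 * u 1 2 - u 0 2 * u 1 0) * hv + (v 0 * u 1 2 - v 2 * u 1 0) * h0 -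
      (v 0 * u 0 2 - v 2 * u 0 0) * h1
  · linear_combination (u 0 0 * u 1 1 - u 0 1 * u 1 0) * hv - (v 0 * u 1 1 - v 1 * u 1 0) * h0 +
      (v 0 * u 0 1 - v 1 * u 0 0) * h1

lemma sum_eq_zero_of_invariantForm {g v : V} (hg : g ≠ 0)
    (h : ∀ u : Fin 2 → V, (∀ i, ∑ j, g j * u i j = 0) → invariantForm v u = 0) :
    ∑ j, g j * v j = 0 := by
  obtain ⟨i, hi⟩ := Function.ne_iff.1 hg
  refine (mul_eq_zero.1 (?_ : g i * _ = 0)).resolve_left hi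
  rw [Fin.sum_univ_three]
  clear hi
  fin_cases i <;> simp only [Fin.zero_eta, Fin.mk_one, Fin.reduceFinMk]
  -- The test vectors are orthogonal to `g` and have cross product `g i • g`; similarly in the other
  -- two cases.
  · have := h ![![g 2, 0, -g 0], ![-g 1, g 0, 0]]
      (Fin.forall_fin_two.2 ⟨by simp [Fin.sum_univ_three]; ring, by simp [Fin.sum_univ_three]; ring⟩)
    simp [invariantForm_apply] at this
    linear_combination this
  · have := h ![![-g 1, g 0, 0], ![0, -g 2, g 1]]
      (Fin.forall_fin_two.2 ⟨by simp [Fin.sum_univ_three]; ring, by simp [Fin.sum_univ_three]; ring⟩)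
    simp [invariantForm_apply] at this
    linear_combination this
  · have := h ![![0, -g 2, g 1], ![g 2, 0, -g 0]]
      (Fin.forall_fin_two.2 ⟨by simp [Fin.sum_univ_three]; ring, by simp [Fin.sum_univ_three]; ring⟩)
    simp [invariantForm_apply] at this
    linear_combination this

lemma invariantCanonicalForm_mem_iff {z : V} (hz : surfaceEq τ b c d z = 0)
    (hg : surfaceGrad τ b c d z ≠ 0) (v : V) :
    invariantCanonicalForm τ (surfaceEq τ b c d) v ∈
      canonicalMap τ (surfaceEq τ b c d) (proj τ z) ↔ ∑ j, surfaceGrad τ b c d z j * v j = 0 := by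
  rw [mem_canonicalMap_iff surfaceEq_mem_sections hz]
  constructor
  · intro h
    refine sum_eq_zero_of_invariantForm hg fun u hu => ?_
    have hu' : ∀ i, u i ∈ tangent (surfaceEq τ b c d) z := fun i => by
      rw [mem_tangent_iff, fderiv_surfaceEq_apply, hu]
    rw [← invariantCanonicalForm_apply (τ := τ) (surfaceEq τ b c d) v ⟨z, hz⟩
      fun i => ⟨u i, hu' i⟩, h]
    rfl
  · intro h
    ext u
    rw [invariantCanonicalForm_apply]
    refine invariantForm_eq_zero hg h fun i => ?_
    rw [← fderiv_surfaceEq_apply, ← mem_tangent_iff]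
    exact (u i).2

lemma isCoatom_canonicalMap {z : V} (hz : surfaceEq τ b c d z = 0)
    (hg : fderiv ℂ (surfaceEq τ b c d) z ≠ 0) :
    IsCoatom (canonicalMap τ (surfaceEq τ b c d) (proj τ z)) := by
  set f := surfaceEq τ b c d with hf
  have hgrad := surfaceGrad_ne_zero_of_fderiv hg
  have hrank : Module.finrank ℂ (tangent f z) = 2 := by
    have h1 : Module.finrank ℂ (tangent f z) + 1 = Module.finrank ℂ V :=
      Module.Dual.finrank_ker_add_one_of_ne_zero (K := ℂ)
        (f := (fderiv ℂ f z : V →ₗ[ℂ] ℂ)) fun h => hg (ContinuousLinearMap.coe_injective h)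
    have h2 : Module.finrank ℂ V = 3 := by simp
    omega
  let B := Module.finBasisOfFinrankEq ℂ (tangent f z) hrank
  -- A 2-form on a plane is determined by its value on a basis, so vanishing at the point is one
  -- linear condition.
  let φ : canonicalForms τ f →ₗ[ℂ] ℂ :=
    { toFun := fun η => η.1 ⟨z, hz⟩ B
      map_add' := fun _ _ => rfl
      map_smul' := fun _ _ => rfl }
  have hker : canonicalMap τ f (proj τ z) = LinearMap.ker φ := by
    ext η
    rw [mem_canonicalMap_iff surfaceEq_mem_sections hz, LinearMap.mem_ker]
    refine ⟨fun h => by change η.1 ⟨z, hz⟩ B = 0; rw [h]; rfl, fun h => ?_⟩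
    rw [AlternatingMap.eq_smul_basis_det B (η.1 ⟨z, hz⟩)]
    change φ η • _ = _
    rw [h, zero_smul]
  rw [hker]
  refine LinearMap.isCoatom_ker_of_surjective (LinearMap.surjective fun h => ?_)
  obtain ⟨i, hi⟩ := Function.ne_iff.1 hgrad
  refine hi ?_
  have := (invariantCanonicalForm_mem_iff hz hgrad (Pi.single i 1)).1 (by rw [← hf, hker, h]; simp)
  simpa [Pi.single_apply] using this

lemma surfaceGrad_proportional {z w : V} (hz : surfaceEq τ b c d z = 0)
    (hw : surfaceEq τ b c d w = 0) (hgz : surfaceGrad τ b c d z ≠ 0)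
    (hgw : surfaceGrad τ b c d w ≠ 0)
    (h : canonicalMap τ (surfaceEq τ b c d) (proj τ z) =
      canonicalMap τ (surfaceEq τ b c d) (proj τ w)) (i j : Fin 3) :
    surfaceGrad τ b c d z i * surfaceGrad τ b c d w j =
      surfaceGrad τ b c d z j * surfaceGrad τ b c d w i := by
  set g := surfaceGrad τ b c d z
  -- The vector `g j e_i - g i e_j` is tangent at `z`, hence also at `w`.
  have h1 : ∑ l, g l * (Pi.single i (g j) - Pi.single j (g i) : V) l = 0 := by
    simp [mul_sub, Finset.sum_sub_distrib, Pi.single_apply, mul_comm]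
  rw [← invariantCanonicalForm_mem_iff hz hgz, h, invariantCanonicalForm_mem_iff hw hgw] at h1
  simp [mul_sub, Finset.sum_sub_distrib, Pi.single_apply] at h1
  linear_combination -h1

/-! ### The gradient at the base points -/

/-- The derivative of `θ_h / θ_{1 - h}` at the zero of `θ_h`. -/
noncomputable def slope (τ : Fin 3 → UpperHalfPlane) (h : Fin 2) (j : Fin 3) : ℂ :=
  deriv (theta h · (τ j)) (root h (τ j)) / theta (1 - h) (root h (τ j)) (τ j)

lemma theta_root_ne_zero {t : ℂ} (ht : 0 < t.im) (h : Fin 2) : theta (1 - h) (root h t) t ≠ 0 :=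
  fun h0 => absurd (eq_of_theta_eq_zero ht (theta_root ht h) h0) (by clear h0; revert h; decide)

lemma slope_ne_zero (h : Fin 2) (j : Fin 3) : slope τ h j ≠ 0 :=
  div_ne_zero (deriv_theta_root_ne_zero (τ j).im_pos h) (theta_root_ne_zero (τ j).im_pos h)

/-- The gradient at the base points of a given type, up to a factor and signs. -/
noncomputable def baseGrad (τ : Fin 3 → UpperHalfPlane) (b c d : ℂ) (k : Fin 2 × Fin 2) :
    Fin 3 → ℂ :=
  if k = (0, 0) then ![b * slope τ 0 0, c * slope τ 0 1, d * slope τ 0 2]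
  else if k = (1, 1) then ![slope τ 0 0, d * slope τ 1 1, c * slope τ 1 2]
  else if k = (0, 1) then ![d * slope τ 1 0, slope τ 0 1, b * slope τ 1 2]
  else ![c * slope τ 1 0, b * slope τ 1 1, slope τ 0 2]

lemma theta_add_nat (h ε : Fin 2) (z t : ℂ) :
    theta h (z + (ε : ℕ)) t = (-1) ^ ((h : ℕ) * ε) * theta h z t := by
  fin_cases ε
  · simp
  · simp [theta_add_one]

lemma deriv_theta_add_nat (h ε : Fin 2) (z t : ℂ) :
    deriv (theta h · t) (z + (ε : ℕ)) = (-1) ^ ((h : ℕ) * ε) * deriv (theta h · t) z := by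
  fin_cases ε
  · simp
  · simp [deriv_theta_add_one]

lemma theta_root_add_ne_zero {t : ℂ} (ht : 0 < t.im) (h ε : Fin 2) :
    theta (1 - h) (root h t + (ε : ℕ)) t ≠ 0 := by
  rw [theta_add_nat]
  exact mul_ne_zero (pow_ne_zero _ (by simp)) (theta_root_ne_zero ht h)

lemma theta_root_add {t : ℂ} (ht : 0 < t.im) (h ε : Fin 2) :
    theta h (root h t + (ε : ℕ)) t = 0 := by
  rw [theta_add_nat, theta_root ht, mul_zero]

/-- Translation by `1` negates `θ₁` and fixes `θ₀`, so the ratio changes sign whichever of the two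
is the numerator. -/
lemma deriv_theta_root_add (h ε : Fin 2) (j : Fin 3) :
    deriv (theta h · (τ j)) (root h (τ j) + (ε : ℕ)) =
      (-1) ^ (ε : ℕ) * slope τ h j * theta (1 - h) (root h (τ j) + (ε : ℕ)) (τ j) := by
  have := theta_root_ne_zero (τ j).im_pos h
  rw [theta_add_nat, deriv_theta_add_nat, slope]
  fin_cases h <;> fin_cases ε <;> simp at this ⊢ <;> field_simp

/-- As `θ_{k j}` vanishes in each coordinate, a single monomial survives in each partial derivative.
The common factor is the product of the nonvanishing theta values. -/
lemma exists_surfaceGrad_baseRep (b c d : ℂ) (q : (Fin 2 × Fin 2) × Fin 2 × Fin 2) :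
    ∃ N ≠ 0, ∀ j, surfaceGrad τ b c d (baseRep τ q) j =
      N * ((-1) ^ (baseShift q j : ℕ) * baseGrad τ b c d q.1 j) := by
  refine ⟨∏ j, theta (1 - baseType q j) (baseRep τ q j) (τ j),
    Finset.prod_ne_zero_iff.2 fun j _ => theta_root_add_ne_zero (τ j).im_pos _ _, ?_⟩
  have h0 : ∀ j, theta (baseType q j) (baseRep τ q j) (τ j) = 0 :=
    fun j => theta_root_add (τ j).im_pos _ _
  have h1 : ∀ j, deriv (theta (baseType q j) · (τ j)) (baseRep τ q j) =
      (-1) ^ (baseShift q j : ℕ) * slope τ (baseType q j) j *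
        theta (1 - baseType q j) (baseRep τ q j) (τ j) := fun j => deriv_theta_root_add _ _ j
  generalize baseRep τ q = z at h0 h1 ⊢
  generalize baseShift q = ε at h1 ⊢
  obtain ⟨⟨k1, k2⟩, s⟩ := q
  have a0 := h0 0
  have a1 := h0 1
  have a2 := h0 2
  have b0 := h1 0
  have b1 := h1 1
  have b2 := h1 2
  intro j
  fin_cases k1 <;> fin_cases k2 <;> fin_cases j <;>
    simp [baseType, surfaceGrad, baseGrad, Fin.prod_univ_three] at a0 a1 a2 b0 b1 b2 ⊢ <;>
    simp only [a0, a1, a2, b0, b1, b2] <;> ring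

/-- The gradients at base points of different types are not proportional, even up to signs. -/
def SeparationCondition (τ : Fin 3 → UpperHalfPlane) (b c d : ℂ) : Prop :=
  ∀ k l : Fin 2 × Fin 2, k ≠ l → ∃ i j : Fin 3,
    baseGrad τ b c d k i ^ 2 * baseGrad τ b c d l j ^ 2 ≠
      baseGrad τ b c d k j ^ 2 * baseGrad τ b c d l i ^ 2

open MvPolynomial in
lemma generic_separationCondition (τ : Fin 3 → UpperHalfPlane) :
    Generic (SeparationCondition τ) := by
  have hs : ∀ h j, slope τ h j ≠ 0 := fun h j => slope_ne_zero h j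
  -- One polynomial for each of the six pairs of types; at the chosen point exactly one of its two
  -- terms survives.
  have g1 := Generic.of_eval_ne_zero ((X 0 * C (slope τ 0 0)) ^ 2 * (X 2 * C (slope τ 1 1)) ^ 2 -
    (X 1 * C (slope τ 0 1)) ^ 2 * C (slope τ 0 0) ^ 2) ![0, 1, 0] (by simp [hs])
  have g2 := Generic.of_eval_ne_zero ((X 0 * C (slope τ 0 0)) ^ 2 * C (slope τ 0 1) ^ 2 -
    (X 1 * C (slope τ 0 1)) ^ 2 * (X 2 * C (slope τ 1 0)) ^ 2) ![1, 0, 0] (by simp [hs])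
  have g3 := Generic.of_eval_ne_zero ((X 0 * C (slope τ 0 0)) ^ 2 * C (slope τ 0 2) ^ 2 -
    (X 2 * C (slope τ 0 2)) ^ 2 * (X 1 * C (slope τ 1 0)) ^ 2) ![1, 0, 0] (by simp [hs])
  have g4 := Generic.of_eval_ne_zero (C (slope τ 0 0) ^ 2 * C (slope τ 0 1) ^ 2 -
    (X 2 * C (slope τ 1 1)) ^ 2 * (X 2 * C (slope τ 1 0)) ^ 2) 0 (by simp [hs])
  have g5 := Generic.of_eval_ne_zero (C (slope τ 0 0) ^ 2 * C (slope τ 0 2) ^ 2 -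
    (X 1 * C (slope τ 1 2)) ^ 2 * (X 1 * C (slope τ 1 0)) ^ 2) 0 (by simp [hs])
  have g6 := Generic.of_eval_ne_zero (C (slope τ 0 1) ^ 2 * C (slope τ 0 2) ^ 2 -
    (X 0 * C (slope τ 1 2)) ^ 2 * (X 0 * C (slope τ 1 1)) ^ 2) 0 (by simp [hs])
  refine (g1.and (g2.and (g3.and (g4.and (g5.and g6))))).mono ?_
  rintro b c d ⟨h1, h2, h3, h4, h5, h6⟩
  simp [sub_eq_zero, -mul_eq_mul_right_iff, -mul_eq_mul_left_iff] at h1 h2 h3 h4 h5 h6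
  have symm : ∀ {k l : Fin 2 × Fin 2} (i j : Fin 3), baseGrad τ b c d k i ^ 2 *
      baseGrad τ b c d l j ^ 2 ≠ baseGrad τ b c d k j ^ 2 * baseGrad τ b c d l i ^ 2 →
      (∃ i j : Fin 3, baseGrad τ b c d k i ^ 2 * baseGrad τ b c d l j ^ 2 ≠
        baseGrad τ b c d k j ^ 2 * baseGrad τ b c d l i ^ 2) ∧
      (∃ i j : Fin 3, baseGrad τ b c d l i ^ 2 * baseGrad τ b c d k j ^ 2 ≠
        baseGrad τ b c d l j ^ 2 * baseGrad τ b c d k i ^ 2) := fun {k l} i j h =>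
    ⟨⟨i, j, h⟩, ⟨j, i, fun e => h (by linear_combination e)⟩⟩
  have s1 := symm (k := (0, 0)) (l := (1, 1)) 0 1 (by simpa [baseGrad, mul_comm] using h1)
  have s2 := symm (k := (0, 0)) (l := (0, 1)) 0 1 (by simpa [baseGrad, mul_comm] using h2)
  have s3 := symm (k := (0, 0)) (l := (1, 0)) 0 2 (by simpa [baseGrad, mul_comm] using h3)
  have s4 := symm (k := (1, 1)) (l := (0, 1)) 0 1 (by simpa [baseGrad, mul_comm] using h4)
  have s5 := symm (k := (1, 1)) (l := (1, 0)) 0 2 (by simpa [baseGrad, mul_comm] using h5)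
  have s6 := symm (k := (0, 1)) (l := (1, 0)) 1 2 (by simpa [baseGrad, mul_comm] using h6)
  rintro ⟨k1, k2⟩ ⟨l1, l2⟩ hkl
  fin_cases k1 <;> fin_cases k2 <;> fin_cases l1 <;> fin_cases l2
  · exact absurd rfl hkl
  · exact s2.1
  · exact s3.1
  · exact s1.1
  · exact s2.2
  · exact absurd rfl hkl
  · exact s6.1
  · exact s4.2
  · exact s3.2
  · exact s6.2
  · exact absurd rfl hkl
  · exact s5.2
  · exact s1.2
  · exact s4.1
  · exact s5.1
  · exact absurd rfl hkl

lemma baseGrad_ne_zero (hb : b ≠ 0) (hc : c ≠ 0) (hd : d ≠ 0) (k : Fin 2 × Fin 2) (j : Fin 3) :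
    baseGrad τ b c d k j ≠ 0 := by
  have hs : ∀ h j, slope τ h j ≠ 0 := fun h j => slope_ne_zero h j
  unfold baseGrad
  split_ifs <;> fin_cases j <;> simp [hs, hb, hc, hd]

lemma injOn_canonicalMap (hb : b ≠ 0) (hc : c ≠ 0) (hd : d ≠ 0)
    (h : SeparationCondition τ b c d) :
    Set.InjOn (canonicalMap τ (surfaceEq τ b c d)) (baseLocus τ) := by
  rw [← range_proj_baseRep]
  rintro _ ⟨q, rfl⟩ _ ⟨r, rfl⟩ heq
  have hz : ∀ q, surfaceEq τ b c d (baseRep τ q) = 0 := fun q =>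
    eq_zero_of_hasType surfaceEq_mem_sections (hasType_baseRep q)
  have hρ := baseGrad_ne_zero (τ := τ) hb hc hd
  have hg : ∀ q, surfaceGrad τ b c d (baseRep τ q) ≠ 0 := fun q h0 => by
    obtain ⟨N, hN, e⟩ := exists_surfaceGrad_baseRep (τ := τ) b c d q
    have := e 0
    rw [h0] at this
    exact mul_ne_zero hN (mul_ne_zero (pow_ne_zero _ (by simp)) (hρ _ _)) this.symm
  have hprop := surfaceGrad_proportional (hz q) (hz r) (hg q) (hg r) heq
  obtain ⟨N, hN, eN⟩ := exists_surfaceGrad_baseRep (τ := τ) b c d q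
  obtain ⟨M, hM, eM⟩ := exists_surfaceGrad_baseRep (τ := τ) b c d r
  have hprop' : ∀ i j, (-1) ^ (baseShift q i : ℕ) * baseGrad τ b c d q.1 i *
      ((-1) ^ (baseShift r j : ℕ) * baseGrad τ b c d r.1 j) =
      (-1) ^ (baseShift q j : ℕ) * baseGrad τ b c d q.1 j *
      ((-1) ^ (baseShift r i : ℕ) * baseGrad τ b c d r.1 i) := fun i j => by
    have := hprop i j
    simp only [eN, eM] at this
    refine mul_left_cancel₀ (mul_ne_zero hN hM) ?_
    linear_combination this
  have htype : q.1 = r.1 := by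
    by_contra hne
    obtain ⟨i, j, hij⟩ := h _ _ hne
    have := congrArg (· ^ 2) (hprop' i j)
    simp only [mul_pow, ← pow_mul, mul_comm _ 2] at this
    simp only [pow_mul, neg_one_sq, one_pow, one_mul] at this
    exact hij this
  -- With equal types only signs can differ, and the sign at coordinate 0 is normalised to `+1`.
  have hshift : ∀ j, baseShift q j = baseShift r j := fun j => by
    have h0 := hprop' 0 j
    rw [htype] at h0
    have e : (-1 : ℂ) ^ (baseShift r j : ℕ) = (-1) ^ (baseShift q j : ℕ) := by
      refine mul_right_cancel₀ (mul_ne_zero (hρ r.1 0) (hρ r.1 j)) ?_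
      have q0 : baseShift q 0 = 0 := rfl
      have r0 : baseShift r 0 = 0 := rfl
      rw [q0, r0] at h0
      simp only [Fin.val_zero, pow_zero, one_mul] at h0
      linear_combination h0
    generalize baseShift q j = x at e ⊢
    generalize baseShift r j = y at e ⊢
    fin_cases x <;> fin_cases y <;> first | rfl | (norm_num at e)
  have : q = r := Prod.ext htype (Prod.ext (hshift 1) (hshift 2))
  rw [this]

end CanonicalMap122

theorem mainTheorem10 (τ : Fin 3 → UpperHalfPlane) :
    (CanonicalMap122.baseLocus τ).ncard = 16 ∧
    ∃ F : MvPolynomial (Fin 3) ℂ, F ≠ 0 ∧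
      ∀ b c d : ℂ, MvPolynomial.eval ![b, c, d] F ≠ 0 →
        CanonicalMap122.IsSmoothDivisor (CanonicalMap122.surfaceEq τ b c d) ∧
        CanonicalMap122.baseLocus τ ⊆ CanonicalMap122.surface τ b c d ∧
        (∀ P ∈ CanonicalMap122.baseLocus τ,
          IsCoatom (CanonicalMap122.canonicalMap τ (CanonicalMap122.surfaceEq τ b c d) P)) ∧
        Set.InjOn (CanonicalMap122.canonicalMap τ (CanonicalMap122.surfaceEq τ b c d))
          (CanonicalMap122.baseLocus τ) := by
  refine ⟨CanonicalMap122.ncard_baseLocus, ?_⟩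
  refine ((CanonicalMap122.generic_smoothCondition τ).and
    (CanonicalMap122.generic_separationCondition τ)).mono ?_
  rintro b c d ⟨hsm, hsep⟩
  have hsmooth := hsm.isSmoothDivisor
  refine ⟨hsmooth, CanonicalMap122.baseLocus_subset_surface, fun P hP => ?_,
    CanonicalMap122.injOn_canonicalMap hsm.1.1 hsm.1.2.1 hsm.1.2.2 hsep⟩
  obtain ⟨z, hz, rfl⟩ := CanonicalMap122.baseLocus_subset_surface (b := b) (c := c) (d := d) hP
  exact CanonicalMap122.isCoatom_canonicalMap hz (hsmooth z hz)
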